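/- Let $N\ge 2$ be an integer, $s\in(0,1)$, $p\in(1,\infty)$, and let $\Omega\subset\mathbb R^N$ be a bounded domain (nonempty, open, connected) with $C^{1,1}$ boundary, i.e. for every $x_0\in\partial\Omega$ there are $r>0$, a unit vector $e$ and a function $\gamma:e^\perp\to\mathbb R$, differentiable with Lipschitz derivative, such that for $x\in B_r(x_0)$ one has $x\in\Omega$ if and only if $x\cdot e>\gamma(x-(x\cdot e)e)$. Put $\delta(x)=\mathrm{dist}(x,\mathbb R^N\setminus\Omega)$ for $x\in\mathbb R^N$, and $\Omega_\rho=\{x\in\Omega:\delta(x)<\rho\}$ for $\rho>0$. For open $U\subseteq\mathbb R^N$ let $W^{s,p}(U)$ be the set of $u\in L^p(U)$ with $\int_{U\times U}\frac{|u(x)-u(y)|^p}{|x-y|^{N+ps}}\,dx\,dy<\infty$, and let $W^{s,p}_0(U)$ be the set of $\varphi\in W^{s,p}(\mathbb R^N)$ with $\varphi=0$ a.e. in $\mathbb R^N\setminus U$. For bounded open $D$ let $\widetilde W^{s,p}(D)$ be the set of $u\in L^p_{\rm loc}(\mathbb R^N)$ such that $u\in W^{s,p}(U)$ for some open $U\supset\overline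 D$ and $\int_{\mathbb R^N}\frac{|u(x)|^{p-1}}{(1+|x|)^{N+ps}}\,dx<\infty$. **Theorem.** There is $\rho>0$ (depending only on $N,p,s,\Omega$) and $f\in L^\infty(\Omega_\rho)$ such that $(-\Delta)_p^s\,\delta^s=f$ weakly in $\Omega_\rho$; that is, $\delta^s\in\widetilde W^{s,p}(\Omega_\rho)$ and, for every $\varphi\in W^{s,p}_0(\Omega_\rho)$, $$\int_{\mathbb R^N\times\mathbb R^N}\frac{|\delta^s(x)-\delta^s(y)|^{p-2}\big(\delta^s(x)-\delta^s(y)\big)\big(\varphi(x)-\varphi(y)\big)}{|x-y|^{N+ps}}\,dx\,dy=\int_{\Omega_\rho}f(x)\,\varphi(x)\,dx,$$ where both integrals converge absolutely, and where $|a|^{p-2}a$ is read as $0$ for $a=0$. -/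

import Mathlib

open MeasureTheory
open scoped NNReal ENNReal

noncomputable section

namespace FracPLap

/-- The space `ℝ^N` with its Euclidean norm. -/
abbrev E (N : ℕ) : Type := EuclideanSpace ℝ (Fin N)

/-- The class `C^{1,1}`: differentiable with Lipschitz continuous derivative. -/
def IsC11 {F : Type*} [NormedAddCommGroup F] [NormedSpace ℝ F] (γ : F → ℝ) : Prop :=
  Differentiable ℝ γ ∧ ∃ L : ℝ≥0, LipschitzWith L (fderiv ℝ γ)

/-- `Ω` has a `C^{1,1}` boundary: near each boundary point `Ω` is, in the direction of some unit
vector `e`, the strict epigraph of a `C^{1,1}` function `γ` on the hyperplane orthogonal to `e`. -/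
def HasC11Boundary {N : ℕ} (Ω : Set (E N)) : Prop :=
  ∀ x₀ ∈ frontier Ω, ∃ r : ℝ, 0 < r ∧ ∃ e : E N, ‖e‖ = 1 ∧
    ∃ γ : (Submodule.span ℝ {e})ᗮ → ℝ, IsC11 γ ∧
      ∀ x ∈ Metric.ball x₀ r,
        x ∈ Ω ↔ γ ((Submodule.span ℝ {e})ᗮ.orthogonalProjectionOnto x) < inner ℝ e x

/-- `δ_Ω(x) = dist(x, Ωᶜ)`. -/
def delta {N : ℕ} (Ω : Set (E N)) (x : E N) : ℝ := Metric.infDist x Ωᶜ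

/-- `Ω_ρ = {x ∈ Ω : δ_Ω(x) < ρ}`. -/
def nearBoundary {N : ℕ} (Ω : Set (E N)) (ρ : ℝ) : Set (E N) := {x ∈ Ω | delta Ω x < ρ}

/-- The signed power `a^q = |a|^{q-1} a`. -/
def spow (a q : ℝ) : ℝ := |a| ^ (q - 1) * a

/-- `∫_{U × U} |u(x) - u(y)|^p / |x - y|^{N + ps} dx dy`. -/
def gagliardo {N : ℕ} (s p : ℝ) (U : Set (E N)) (u : E N → ℝ) : ℝ≥0∞ :=
  ∫⁻ z in U ×ˢ U, ENNReal.ofReal (|u z.1 - u z.2| ^ p / ‖z.1 - z.2‖ ^ ((N : ℝ) + p * s))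

/-- `u ∈ W^{s,p}(U)`. -/
def MemW {N : ℕ} (s p : ℝ) (U : Set (E N)) (u : E N → ℝ) : Prop :=
  MemLp u (ENNReal.ofReal p) (volume.restrict U) ∧ gagliardo s p U u < ∞

/-- `u ∈ W^{s,p}_0(Ω)`: `u ∈ W^{s,p}(ℝ^N)` and `u = 0` (almost everywhere) in `Ωᶜ`. -/
def MemW0 {N : ℕ} (s p : ℝ) (Ω : Set (E N)) (u : E N → ℝ) : Prop :=
  MemW s p Set.univ u ∧ ∀ᵐ x, x ∉ Ω → u x = 0

/-- `u ∈ W̃^{s,p}(Ω)` for a bounded set `Ω`: `u ∈ L^p_loc(ℝ^N)`, `u ∈ W^{s,p}(U)` for some open `U`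
containing the (compact) closure of `Ω`, and `∫ |u(x)|^{p-1} / (1 + |x|)^{N + ps} dx < ∞`. -/
def MemWtilde {N : ℕ} (s p : ℝ) (Ω : Set (E N)) (u : E N → ℝ) : Prop :=
  (∀ K : Set (E N), IsCompact K → MemLp u (ENNReal.ofReal p) (volume.restrict K)) ∧
  (∃ U : Set (E N), IsOpen U ∧ closure Ω ⊆ U ∧ MemW s p U u) ∧
  ∫⁻ x, ENNReal.ofReal (|u x| ^ (p - 1) / (1 + ‖x‖) ^ ((N : ℝ) + p * s)) < ∞

/-- The integrand `(u(x) - u(y))^{p-1} (φ(x) - φ(y)) / |x - y|^{N + ps}` of the weak form. -/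
def weakIntegrand {N : ℕ} (s p : ℝ) (u φ : E N → ℝ) (z : E N × E N) : ℝ :=
  spow (u z.1 - u z.2) (p - 1) * (φ z.1 - φ z.2) / ‖z.1 - z.2‖ ^ ((N : ℝ) + p * s)

/-- `u` is a weak solution of `(-Δ)_p^s u = f` in the bounded set `Ω`, where the function `f` acts
on test functions by `φ ↦ ∫_Ω f φ`. The absolute convergence of both integrals is part of the
definition. -/
def IsWeakSolution {N : ℕ} (s p : ℝ) (Ω : Set (E N)) (u f : E N → ℝ) : Prop :=
  MemWtilde s p Ω u ∧
  ∀ φ : E N → ℝ, MemW0 s p Ω φ →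
    Integrable (weakIntegrand s p u φ) ∧ IntegrableOn (fun x => f x * φ x) Ω ∧
      ∫ z, weakIntegrand s p u φ z = ∫ x in Ω, f x * φ x

end FracPLap

end

open MeasureTheory
open scoped NNReal ENNReal

noncomputable section

namespace FracPLap

/-! ### Signed distance and the two-sided ball condition -/

section Geometry

variable {V : Type*} [NormedAddCommGroup V]

/-! The model is a half-space: `t_+ ^ s` is annihilated by the one-dimensional operator on `t > 0`,
and integrating the kernel over hyperplanes orthogonal to the normal reduces a half-space of `ℝ^N`
to one dimension. Near a `C^{1,1}` boundary the domain is compared with a half-space; the comparison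
gains one power of `|x - y|`, just enough for a bounded right-hand side.

Comparison. Interior and exterior balls make the signed distance affine up to `|y - x|² / R` around
each point near the boundary (`TwoBall.expansion`). Adding this remainder along the normal `n` gives
a map `h` that makes the signed distance exactly affine (`TwoBall.exists_straightens`). The kernel
and its pullback differ by `O(|y - x|^{1-N-ps})`; against `|δ(x)^s - δ(y)^s|^{p-1} ≤ |x -
y|^{s(p-1)}` this leaves `|x - y|^{1-s-N}`, integrable near `x` because `s < 1`
(`Straightens.abs_comparisonError_le`).

Principal value. Instead of a ball around `x`, the truncation `profile` removes the pairs with `κ <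
δ(y)/δ(x) < 1/κ`. It sees only values of `δ`, so `h` transports it exactly; it is antisymmetric, so
the weak form separates; it is homogeneous, so the half-space value can be computed. That value is a
multiple of `d^{-s}` times `profileDefect`, which vanishes as `κ → 1` (`integral_profile`). Hence
the truncated operators converge pointwise to a bounded limit (`exists_tendsto_truncOp`), and `f` is
twice this limit.

Passage to the limit in the weak form. Uniformly in `κ` the truncated operators are bounded only by
`C + C' δ^{-s}`; Hardy's inequality (`TwoBall.hardy`) makes `δ^{-s} |φ|` integrable, so dominated
convergence applies. On the other side the weak integrand itself dominates, integrable because `δ^s`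
has finite energy (`TwoBall.gagliardo_delta_rpow_lt_top`). -/

/-- The signed distance to the boundary of `S`, positive inside `S`. -/
def sdist (S : Set V) (x : V) : ℝ := Metric.infDist x Sᶜ - Metric.infDist x S

lemma sdist_compl (S : Set V) (x : V) : sdist Sᶜ x = -sdist S x := by
  simp [sdist]

lemma sdist_of_mem {S : Set V} {x : V} (hx : x ∈ S) : sdist S x = Metric.infDist x Sᶜ := by
  simp [sdist, Metric.infDist_zero_of_mem hx]

lemma sdist_of_notMem {S : Set V} {x : V} (hx : x ∉ S) : sdist S x = -Metric.infDist x S := by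
  have : x ∈ Sᶜ := hx
  simp [sdist, Metric.infDist_zero_of_mem this]

/-- Through this identity any function of `δ` becomes a function of the signed distance, which is
the quantity that can be straightened across the boundary. -/
lemma max_sdist (S : Set V) (x : V) : max (sdist S x) 0 = Metric.infDist x Sᶜ := by
  by_cases hx : x ∈ S
  · rw [sdist_of_mem hx, max_eq_left Metric.infDist_nonneg]
  · have : x ∈ Sᶜ := hx
    rw [sdist_of_notMem hx, Metric.infDist_zero_of_mem this, max_eq_right]
    simp [Metric.infDist_nonneg]

lemma abs_sdist_sub_le (S : Set V) (x y : V) : |sdist S x - sdist S y| ≤ 2 * ‖x - y‖ := by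
  have h1 := (Metric.lipschitz_infDist_pt Sᶜ).dist_le_mul x y
  have h2 := (Metric.lipschitz_infDist_pt S).dist_le_mul x y
  simp only [Real.dist_eq, NNReal.coe_one, one_mul, dist_eq_norm x y] at h1 h2
  unfold sdist
  rw [abs_le] at *
  constructor <;> linarith [h1.1, h1.2, h2.1, h2.2]

lemma continuous_sdist (S : Set V) : Continuous (sdist S) :=
  (Metric.continuous_infDist_pt _).sub (Metric.continuous_infDist_pt _)

variable [InnerProductSpace ℝ V]

/-- Balls of radius `R`, one inside `S` and one outside, touch each other at `z`. -/
def TwoBallAt (R : ℝ) (S : Set V) (z : V) : Prop :=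
  ∃ n : V, ‖n‖ = 1 ∧ Metric.ball (z + R • n) R ⊆ S ∧ Metric.ball (z - R • n) R ⊆ Sᶜ

/-- The two-sided ball condition of radius `R` at all boundary points of `S`. -/
def TwoBall (R : ℝ) (S : Set V) : Prop := ∀ z ∈ frontier S, TwoBallAt R S z

lemma TwoBall.compl {R : ℝ} {S : Set V} (h : TwoBall R S) : TwoBall R Sᶜ := by
  intro z hz
  rw [frontier_compl] at hz
  obtain ⟨n, hn, h1, h2⟩ := h z hz
  refine ⟨-n, by simpa using hn, ?_, ?_⟩
  · simpa [sub_eq_add_neg] using h2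
  · simpa using h1

lemma TwoBallAt.mono {R R' : ℝ} {S : Set V} {z : V} (h : TwoBallAt R S z) (hR : R' ≤ R) :
    TwoBallAt R' S z := by
  obtain ⟨n, hn, h1, h2⟩ := h
  refine ⟨n, hn, (Metric.ball_subset_ball' ?_).trans h1, (Metric.ball_subset_ball' ?_).trans h2⟩
  · rw [dist_add_left, dist_eq_norm, ← sub_smul, norm_smul, hn, Real.norm_eq_abs,
      abs_of_nonpos (by linarith)]
    linarith
  · rw [dist_sub_left, dist_eq_norm, ← sub_smul, norm_smul, hn, Real.norm_eq_abs,
      abs_of_nonpos (by linarith)]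
    linarith

/-- Inside `S` this is the triangle inequality. Outside, the radial projection of `y` to the closed
ball lies in the closure of `S` and bounds the distance to `S`. -/
lemma sub_dist_le_sdist {S : Set V} {c : V} {R : ℝ} (hR : 0 < R) (hc : Metric.ball c R ⊆ S)
    (hS : Sᶜ.Nonempty) (y : V) : R - dist y c ≤ sdist S y := by
  by_cases hy : y ∈ S
  · rw [sdist_of_mem hy, Metric.le_infDist hS]
    intro w hw
    by_contra! h
    exact hw (hc (by
      rw [Metric.mem_ball]
      linarith [dist_triangle w y c, dist_comm w y]))
  · rw [sdist_of_notMem hy]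
    have hyc : R ≤ dist y c := by
      by_contra! h
      exact hy (hc h)
    have hpos : 0 < ‖y - c‖ := by
      rw [← dist_eq_norm]
      linarith
    have hcl : Metric.closedBall c R ⊆ closure S := by
      rw [← closure_ball c hR.ne']
      exact closure_mono hc
    have hw : c + (R / ‖y - c‖) • (y - c) ∈ closure S := by
      apply hcl
      rw [Metric.mem_closedBall, dist_eq_norm, add_sub_cancel_left, norm_smul, norm_div, norm_norm,
        div_mul_cancel₀ _ hpos.ne', Real.norm_eq_abs, abs_of_pos hR]
    have := Metric.infDist_le_dist_of_mem (x := y) hw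
    rw [Metric.infDist_closure] at this
    have e : y - (c + (R / ‖y - c‖) • (y - c)) = (1 - R / ‖y - c‖) • (y - c) := by
      rw [sub_smul, one_smul]
      abel
    rw [dist_eq_norm, e, norm_smul, Real.norm_eq_abs, abs_of_nonneg, sub_mul,
      div_mul_cancel₀ _ hpos.ne'] at this
    · rw [dist_eq_norm]
      linarith
    · rw [dist_eq_norm] at hyc
      rw [sub_nonneg, div_le_one hpos]
      exact hyc

lemma sdist_le_dist_sub {S : Set V} {c : V} {R : ℝ} (hR : 0 < R) (hc : Metric.ball c R ⊆ Sᶜ)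
    (hS : S.Nonempty) (y : V) : sdist S y ≤ dist y c - R := by
  have := sub_dist_le_sdist hR hc (by simpa using hS) y
  rw [sdist_compl] at this
  linarith

/-- At a nearest boundary point `z` the ball `B(x, d)` and the exterior ball are disjoint and both
touch `z`. This forces `x = z + d n`, so the balls at `z` can be recentred relative to `x`. -/
lemma TwoBall.exists_normal_of_mem [FiniteDimensional ℝ V] {R : ℝ} {S : Set V} (h : TwoBall R S)
    (hR : 0 < R) (hS' : Sᶜ.Nonempty) {x : V} (hx : x ∈ S) :
    ∃ n : V, ‖n‖ = 1 ∧ Metric.ball (x + (R - Metric.infDist x Sᶜ) • n) R ⊆ S ∧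
      Metric.ball (x - (R + Metric.infDist x Sᶜ) • n) R ⊆ Sᶜ := by
  have : ProperSpace V := FiniteDimensional.proper_real V
  obtain ⟨z, hz, hzd⟩ := isClosed_closure.exists_infDist_eq_dist (hS'.mono subset_closure) x
  rw [Metric.infDist_closure] at hzd
  set d := Metric.infDist x Sᶜ with hd
  have hd0 : 0 ≤ d := Metric.infDist_nonneg
  have hball : Metric.ball x d ⊆ S := by
    intro w hw
    by_contra hw'
    have : d ≤ dist x w := Metric.infDist_le_dist_of_mem hw'
    rw [Metric.mem_ball, dist_comm] at hw
    linarith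
  have hzf : z ∈ frontier S := by
    rw [frontier_eq_closure_inter_closure]
    refine ⟨?_, hz⟩
    rcases hd0.eq_or_lt with h0 | h0
    · rw [← h0] at hzd
      rw [← dist_eq_zero.1 hzd.symm]
      exact subset_closure hx
    · have : Metric.closedBall x d ⊆ closure S := by
        rw [← closure_ball x h0.ne']
        exact closure_mono hball
      exact this (by rw [Metric.mem_closedBall, dist_comm, ← hzd])
  obtain ⟨n, hn, h1, h2⟩ := h z hzf
  have hxz : x = z + d • n := by
    rcases hd0.eq_or_lt with h0 | h0
    · rw [← h0] at hzd ⊢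
      rw [← dist_eq_zero.1 hzd.symm]
      simp
    · have hdisj : Disjoint (Metric.ball x d) (Metric.ball (z - R • n) R) :=
        (disjoint_compl_right (a := S)).mono hball h2
      rw [disjoint_ball_ball_iff h0 hR, dist_eq_norm] at hdisj
      have e : x - (z - R • n) = (x - z) + R • n := by abel
      rw [e] at hdisj
      have hsq : (d + R) ^ 2 ≤ ‖(x - z) + R • n‖ ^ 2 := by gcongr
      rw [norm_add_sq_real, norm_smul, hn, ← dist_eq_norm, ← hzd, Real.norm_eq_abs, mul_one,
        sq_abs, inner_smul_right] at hsq
      -- Equality case of Cauchy-Schwarz: `|x - z| = d ≤ ⟪x - z, n⟫` with `n` a unit vector.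
      have hin : d ≤ inner ℝ (x - z) n := by
        have : R * d ≤ R * inner ℝ (x - z) n := by nlinarith
        exact le_of_mul_le_mul_left this hR
      have : ‖(x - z) - d • n‖ ^ 2 ≤ 0 := by
        rw [norm_sub_sq_real, norm_smul, hn, ← dist_eq_norm, ← hzd, Real.norm_eq_abs, mul_one,
          sq_abs, inner_smul_right]
        nlinarith
      have h0 : (x - z) - d • n = 0 := by
        rw [← norm_eq_zero]
        exact pow_eq_zero_iff (two_ne_zero) |>.1 (le_antisymm this (sq_nonneg _))
      rw [sub_eq_zero, sub_eq_iff_eq_add] at h0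
      rw [h0, add_comm]
  refine ⟨n, hn, ?_, ?_⟩
  · convert h1 using 2
    nth_rewrite 1 [hxz]
    module
  · convert h2 using 2
    nth_rewrite 1 [hxz]
    module

/-- The two balls squeeze the signed distance between `R - |y - c₁|` and `|y - c₂| - R`. Both bounds
equal `d + ⟪n, y - x⟫` up to a quadratic error. -/
lemma TwoBall.expansion_of_mem [FiniteDimensional ℝ V] {R : ℝ} {S : Set V} (h : TwoBall R S)
    (hR : 0 < R) (hS : S.Nonempty) (hS' : Sᶜ.Nonempty) {x : V} (hx : x ∈ S)
    (hxR : sdist S x < R / 2) :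
    ∃ n : V, ‖n‖ = 1 ∧
      ∀ y, |sdist S y - sdist S x - inner ℝ n (y - x)| ≤ ‖y - x‖ ^ 2 / R := by
  obtain ⟨n, hn, h1, h2⟩ := h.exists_normal_of_mem hR hS' hx
  refine ⟨n, hn, fun y => ?_⟩
  have hd0 : 0 ≤ Metric.infDist x Sᶜ := Metric.infDist_nonneg
  rw [sdist_of_mem hx] at hxR ⊢
  set d := Metric.infDist x Sᶜ with hd
  -- From `2 A t ≤ t² + A²` with `t` the distance to the centre. The inner centre is `ε = -1`, `A =
  -- R - d`, the outer one `ε = 1`, `A = R + d`; `d < R / 2` gives `A ≥ R / 2`.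
  have key : ∀ A : ℝ, ∀ ε : ℝ, ε ^ 2 = 1 → R / 2 ≤ A →
      dist y (x - (ε * A) • n) ≤ A + ε * inner ℝ n (y - x) + ‖y - x‖ ^ 2 / R := by
    intro A ε hε hA
    have hA0 : 0 < A := by linarith
    have e : y - (x - (ε * A) • n) = (y - x) + (ε * A) • n := by abel
    have hsq : dist y (x - (ε * A) • n) ^ 2 = ‖y - x‖ ^ 2 + 2 * (ε * A * inner ℝ n (y - x)) + A ^ 2 := by
      rw [dist_eq_norm, e, norm_add_sq_real, norm_smul, hn, Real.norm_eq_abs, mul_one,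
        sq_abs, inner_smul_right, mul_pow, hε, one_mul, real_inner_comm]
    have h3 : 2 * A * dist y (x - (ε * A) • n) ≤
        2 * A * (A + ε * inner ℝ n (y - x) + ‖y - x‖ ^ 2 / (2 * A)) := by
      have : 2 * A * (A + ε * inner ℝ n (y - x) + ‖y - x‖ ^ 2 / (2 * A)) =
        2 * A ^ 2 + 2 * (ε * A * inner ℝ n (y - x)) + ‖y - x‖ ^ 2 := by
        field_simp
      rw [this]
      nlinarith [sq_nonneg (dist y (x - (ε * A) • n) - A)]
    have h4 := le_of_mul_le_mul_left h3 (by positivity)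
    have h5 : ‖y - x‖ ^ 2 / (2 * A) ≤ ‖y - x‖ ^ 2 / R := by
      gcongr
      linarith
    linarith
  have hlo := sub_dist_le_sdist hR h1 hS' y
  have hhi := sdist_le_dist_sub hR h2 hS y
  have k1 := key (R - d) (-1) (by norm_num) (by linarith)
  have k2 := key (R + d) 1 (by norm_num) (by linarith)
  rw [neg_one_mul, neg_smul, sub_neg_eq_add] at k1
  rw [one_mul] at k2
  rw [abs_le]
  constructor <;> linarith

/-- Near the boundary the signed distance is, up to a quadratic error, affine at each point. -/
lemma TwoBall.expansion [FiniteDimensional ℝ V] {R : ℝ} {S : Set V} (h : TwoBall R S)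
    (hR : 0 < R) (hS : S.Nonempty) (hS' : Sᶜ.Nonempty) {x : V} (hxR : |sdist S x| < R / 2) :
    ∃ n : V, ‖n‖ = 1 ∧
      ∀ y, |sdist S y - sdist S x - inner ℝ n (y - x)| ≤ ‖y - x‖ ^ 2 / R := by
  rw [abs_lt] at hxR
  by_cases hx : x ∈ S
  · exact h.expansion_of_mem hR hS hS' hx hxR.2
  · obtain ⟨n, hn, h1⟩ := h.compl.expansion_of_mem hR hS' (by simpa using hS)
      (show x ∈ Sᶜ from hx) (by rw [sdist_compl]; linarith)
    refine ⟨-n, by simpa using hn, fun y => ?_⟩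
    have := h1 y
    rw [sdist_compl, sdist_compl, ← abs_neg] at this
    convert this using 2
    rw [inner_neg_left]
    ring

/-- Compare both expansions at `y + e`, with `e` parallel to `m - n` and of length `|y - x|`, and
the first one at `y`. The errors are `4 + 1 + 1` times `|y - x|² / R`. -/
lemma norm_sub_le_of_expansion {D : V → ℝ} {R : ℝ} (hR : 0 < R) {x y n m : V}
    (hx : ∀ z, |D z - D x - inner ℝ n (z - x)| ≤ ‖z - x‖ ^ 2 / R)
    (hy : ∀ z, |D z - D y - inner ℝ m (z - y)| ≤ ‖z - y‖ ^ 2 / R) :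
    ‖m - n‖ ≤ 6 / R * ‖y - x‖ := by
  by_cases hmn : m - n = 0
  · rw [hmn, norm_zero]
    positivity
  have hmn' : 0 < ‖m - n‖ := norm_pos_iff.2 hmn
  by_cases hxy : y - x = 0
  · have hyx : y = x := sub_eq_zero.1 hxy
    subst hyx
    exfalso
    -- the two affine approximations at one point agree to first order
    have hb : ∀ t : ℝ, 0 < t → ‖m - n‖ ^ 2 ≤ t * (2 * ‖m - n‖ ^ 2 / R) := by
      intro t ht
      have h1 := abs_le.1 (hx (y + t • (m - n)))
      have h2 := abs_le.1 (hy (y + t • (m - n)))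
      rw [add_sub_cancel_left, norm_smul, inner_smul_right, mul_pow, Real.norm_eq_abs, sq_abs] at h1 h2
      have h3 : t * ‖m - n‖ ^ 2 = t * inner ℝ m (m - n) - t * inner ℝ n (m - n) := by
        rw [← mul_sub, ← inner_sub_left, real_inner_self_eq_norm_sq]
      have h4 : t * ‖m - n‖ ^ 2 ≤ t * (t * (2 * ‖m - n‖ ^ 2 / R)) := by
        have : t * (t * (2 * ‖m - n‖ ^ 2 / R)) = 2 * (t ^ 2 * ‖m - n‖ ^ 2 / R) := by ring
        rw [this, h3]
        linarith [h1.1, h1.2, h2.1, h2.2]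
      exact le_of_mul_le_mul_left h4 ht
    -- Any `t < R / 2` makes the factor `2 t / R` smaller than one and yields the contradiction.
    have h1 := hb (R / 4) (by positivity)
    have : R / 4 * (2 * ‖m - n‖ ^ 2 / R) = ‖m - n‖ ^ 2 / 2 := by
      field_simp
      ring
    rw [this] at h1
    nlinarith [sq_pos_of_pos hmn']
  have hr : 0 < ‖y - x‖ := norm_pos_iff.2 hxy
  set r := ‖y - x‖ with hrdef
  set e : V := (r / ‖m - n‖) • (m - n) with he
  have hen : ‖e‖ = r := by
    rw [he, norm_smul, Real.norm_of_nonneg (by positivity), div_mul_cancel₀ _ hmn'.ne']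
  have h1 := abs_le.1 (hx (y + e))
  have h2 := abs_le.1 (hy (y + e))
  have h3 := abs_le.1 (hx y)
  rw [← hrdef] at h3
  have e1 : y + e - x = (y - x) + e := by abel
  rw [e1, inner_add_right] at h1
  rw [add_sub_cancel_left, hen] at h2
  have h4 : ‖(y - x) + e‖ ^ 2 / R ≤ (2 * r) ^ 2 / R := by
    gcongr
    refine (norm_add_le _ _).trans ?_
    rw [hen]
    linarith
  have h5 : inner ℝ m e - inner ℝ n e = r * ‖m - n‖ := by
    rw [← inner_sub_left, he, inner_smul_right, real_inner_self_eq_norm_sq]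
    field_simp
  have h6 : r * ‖m - n‖ ≤ r * (6 / R * r) := by
    have : r * (6 / R * r) = (2 * r) ^ 2 / R + r ^ 2 / R + r ^ 2 / R := by ring
    rw [this, ← h5]
    linarith [h1.1, h1.2, h2.1, h2.2, h3.1, h3.2]
  exact le_of_mul_le_mul_left h6 hr

lemma hasFDerivAt_of_expansion {D : V → ℝ} {R : ℝ} {x n : V}
    (hx : ∀ z, |D z - D x - inner ℝ n (z - x)| ≤ ‖z - x‖ ^ 2 / R) :
    HasFDerivAt D (innerSL ℝ n) x := by
  rw [hasFDerivAt_iff_isLittleO]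
  refine Asymptotics.IsBigO.trans_isLittleO (g := fun z => ‖z - x‖ ^ 2) ?_
    (Asymptotics.isLittleO_pow_sub_sub x one_lt_two)
  refine Asymptotics.IsBigO.of_bound (1 / R) (Filter.Eventually.of_forall fun z => ?_)
  have := hx z
  rw [Real.norm_eq_abs, innerSL_apply_apply, norm_pow, norm_norm]
  convert this using 1
  ring

end Geometry

/-! ### From a `C^{1,1}` boundary to uniform tangent balls -/

section BallCondition

lemma abs_sub_sub_fderiv_le {F : Type*} [NormedAddCommGroup F] [NormedSpace ℝ F] {γ : F → ℝ}
    (hγ : Differentiable ℝ γ) {L : ℝ≥0} (hL : LipschitzWith L (fderiv ℝ γ)) (a b : F) :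
    |γ b - γ a - fderiv ℝ γ a (b - a)| ≤ L * ‖b - a‖ ^ 2 := by
  have h := Convex.norm_image_sub_le_of_norm_hasFDerivWithin_le' (f := γ) (f' := fderiv ℝ γ)
    (φ := fderiv ℝ γ a) (s := Metric.closedBall a ‖b - a‖) (x := a) (y := b) (C := L * ‖b - a‖)
    (fun x _ => (hγ x).hasFDerivAt.hasFDerivWithinAt)
    (fun x hx => ?_) (convex_closedBall _ _) (Metric.mem_closedBall_self (norm_nonneg _))
    (by rw [Metric.mem_closedBall, dist_eq_norm])
  · rw [Real.norm_eq_abs] at h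
    rwa [sq, ← mul_assoc]
  · have := hL.dist_le_mul x a
    rw [dist_eq_norm] at this
    refine this.trans ?_
    gcongr
    exact hx

variable {V : Type*} [NormedAddCommGroup V] [InnerProductSpace ℝ V]

/-- The strict epigraph of a `C^{1,1}` function satisfies the two-sided ball condition. -/
lemma twoBallAt_of_epigraph {S : Set V} (hS : IsOpen S) {x₀ e : V} {r : ℝ} (hr : 0 < r)
    (he : ‖e‖ = 1) {K : Submodule ℝ V} [CompleteSpace K] (hK : ∀ k ∈ K, inner ℝ e k = 0)
    {γ : K → ℝ} (hγ : Differentiable ℝ γ) {L : ℝ≥0} (hL : LipschitzWith L (fderiv ℝ γ))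
    (hγS : ∀ x ∈ Metric.ball x₀ r, x ∈ S ↔ γ (K.orthogonalProjectionOnto x) < inner ℝ e x)
    {z : V} (hz : z ∈ frontier S) (hzr : z ∈ Metric.ball x₀ (r / 2)) :
    TwoBallAt (min (r / 4) (1 / (2 * (L + 1)))) S z := by
  -- The first entry keeps both balls, of diameter `2 R ≤ r / 2`, inside the chart; the second makes
  -- them beat the curvature of the graph. `L + 1` avoids division by zero.
  set R : ℝ := min (r / 4) (1 / (2 * (L + 1))) with hRdef
  have hR : 0 < R := by positivity
  have hRr : R ≤ r / 4 := min_le_left _ _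
  have hRL : R ≤ 1 / (2 * (L + 1)) := min_le_right _ _
  set P := K.orthogonalProjectionOnto with hP
  have hzr' : z ∈ Metric.ball x₀ r := Metric.ball_subset_ball (by linarith) hzr
  have hzS : z ∉ S := by
    rw [hS.frontier_eq] at hz
    exact hz.2
  have hγz : γ (P z) = inner ℝ e z := by
    apply le_antisymm
    · by_contra! h
      have hc : ∀ᶠ x in nhds z, inner ℝ e x < γ (P x) :=
        ContinuousAt.eventually_lt (by fun_prop)
          (hγ.continuous.comp P.continuous).continuousAt h
      obtain ⟨x, ⟨hx1, hx2⟩, hx3⟩ := mem_closure_iff_nhds.1 (frontier_subset_closure hz) _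
        (hc.and (Metric.isOpen_ball.mem_nhds hzr'))
      exact hx1.not_gt ((hγS x hx2).1 hx3)
    · by_contra! h
      exact hzS ((hγS z hzr').2 h)
  -- The gradient of `γ`, so that `m = e - g` is the gradient at `z` of the defining function `⟪e,
  -- x⟫ - γ(P x)`. As `g ⟂ e`, its norm is at least one.
  set g : K := (InnerProductSpace.toDual ℝ K).symm (fderiv ℝ γ (P z)) with hg
  have hgw : ∀ w, fderiv ℝ γ (P z) (P w) = inner ℝ (g : V) w := by
    intro w
    rw [← Submodule.inner_orthogonalProjectionOnto_eq_of_mem_left, hg,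
      InnerProductSpace.toDual_symm_apply]
  set m : V := e - g with hm
  have hm1 : 1 ≤ ‖m‖ := by
    have h1 : inner ℝ e m = 1 := by
      rw [hm, inner_sub_right, hK g g.2, real_inner_self_eq_norm_sq, he]
      norm_num
    have h2 := real_inner_le_norm e m
    rwa [h1, he, one_mul] at h2
  have hm0 : 0 < ‖m‖ := by linarith
  set n : V := ‖m‖⁻¹ • m with hn
  have hn1 : ‖n‖ = 1 := by
    rw [hn, norm_smul, norm_inv, norm_norm, inv_mul_cancel₀ hm0.ne']
  have hmn : ∀ w, inner ℝ m w = ‖m‖ * inner ℝ n w := by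
    intro w
    rw [hn, real_inner_smul_left, mul_inv_cancel_left₀ hm0.ne']
  have hdesc : ∀ w, |γ (P (z + w)) - inner ℝ e (z + w) + inner ℝ m w| ≤ L * ‖w‖ ^ 2 := by
    intro w
    have h1 := abs_sub_sub_fderiv_le hγ hL (P z) (P (z + w))
    have h2 : P (z + w) - P z = P w := by rw [map_add, add_sub_cancel_left]
    rw [h2, hγz, hgw] at h1
    have h3 : (L : ℝ) * ‖P w‖ ^ 2 ≤ L * ‖w‖ ^ 2 := by
      gcongr
      exact K.norm_orthogonalProjectionOnto_apply_le w
    refine le_trans (le_of_eq ?_) (h1.trans h3)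
    congr 1
    rw [hm, inner_sub_left, inner_add_right]
    ring
  -- In the ball tangent at `z` on the side `σ = ±1`, `w = x - z` satisfies `|w|² < 2 R σ ⟪n, w⟫`,
  -- so the linear term dominates the Taylor error `L |w|²`.
  have hball : ∀ σ : ℝ, σ ^ 2 = 1 → ∀ x ∈ Metric.ball (z + (σ * R) • n) R,
      x ∈ Metric.ball x₀ r ∧ L * ‖x - z‖ ^ 2 < σ * inner ℝ m (x - z) := by
    intro σ hσ x hx
    have hσ' : |σ| = 1 := by
      rw [← sq_eq_sq₀ (abs_nonneg _) zero_le_one, sq_abs, hσ, one_pow]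
    rw [Metric.mem_ball, dist_eq_norm] at hx
    set w := x - z with hw
    have e1 : x - (z + (σ * R) • n) = w - (σ * R) • n := by
      rw [hw]
      abel
    rw [e1] at hx
    have hnR : ‖(σ * R) • n‖ = R := by
      rw [norm_smul, hn1, mul_one, norm_mul, Real.norm_eq_abs, hσ', one_mul, Real.norm_eq_abs,
        abs_of_pos hR]
    have hw2 : ‖w‖ < 2 * R := by
      have := norm_le_norm_sub_add w ((σ * R) • n)
      rw [hnR] at this
      linarith
    constructor
    · rw [Metric.mem_ball] at hzr ⊢
      have := dist_triangle x z x₀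
      rw [dist_eq_norm x z, ← hw] at this
      linarith
    · have h1 : ‖w - (σ * R) • n‖ ^ 2 < R ^ 2 := by gcongr
      rw [norm_sub_sq_real, hnR, inner_smul_right, real_inner_comm] at h1
      have h2 : ‖w‖ ^ 2 < 2 * R * (σ * inner ℝ n w) := by linarith
      have h3 : 0 < σ * inner ℝ n w := by
        have : 0 < 2 * R * (σ * inner ℝ n w) := lt_of_le_of_lt (sq_nonneg _) h2
        exact pos_of_mul_pos_right this (by positivity)
      have h4 : 2 * R * (L + 1) ≤ 1 := by
        have := mul_le_mul_of_nonneg_right hRL (show (0 : ℝ) ≤ 2 * (L + 1) by positivity)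
        rw [one_div, inv_mul_cancel₀ (by positivity)] at this
        linarith
      calc L * ‖w‖ ^ 2 ≤ (L + 1) * ‖w‖ ^ 2 := by gcongr; linarith
        _ < (L + 1) * (2 * R * (σ * inner ℝ n w)) := by gcongr
        _ = 2 * R * (L + 1) * (σ * inner ℝ n w) := by ring
        _ ≤ 1 * (σ * inner ℝ n w) := by gcongr
        _ ≤ ‖m‖ * (σ * inner ℝ n w) := by gcongr
        _ = σ * inner ℝ m w := by rw [hmn]; ring
  refine ⟨n, hn1, fun x hx => ?_, fun x hx => ?_⟩
  · obtain ⟨h1, h2⟩ := hball 1 (by norm_num) x (by rwa [one_mul])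
    rw [hγS x h1]
    have h3 := abs_le.1 (hdesc (x - z))
    rw [add_sub_cancel] at h3
    linarith [h3.2]
  · obtain ⟨h1, h2⟩ := hball (-1) (by norm_num) x
      (by rwa [neg_one_mul, neg_smul, ← sub_eq_add_neg])
    rw [Set.mem_compl_iff, hγS x h1, not_lt]
    have h3 := abs_le.1 (hdesc (x - z))
    rw [add_sub_cancel] at h3
    linarith [h3.1]

/-- A bounded open set with `C^{1,1}` boundary satisfies a uniform two-sided ball condition. -/
lemma HasC11Boundary.exists_twoBall {N : ℕ} {Ω : Set (E N)} (hΩ : HasC11Boundary Ω)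
    (ho : IsOpen Ω) (hb : Bornology.IsBounded Ω) : ∃ R : ℝ, 0 < R ∧ TwoBall R Ω := by
  have hc : IsCompact (frontier Ω) :=
    hb.isCompact_closure.of_isClosed_subset isClosed_frontier frontier_subset_closure
  -- The doubled membership lets the compactness induction run over arbitrary sets, such as balls,
  -- while claiming something only at boundary points.
  suffices h : ∃ R : ℝ, 0 < R ∧ ∀ z ∈ frontier Ω, z ∈ frontier Ω → TwoBallAt R Ω z by
    obtain ⟨R, hR, h⟩ := h
    exact ⟨R, hR, fun z hz => h z hz hz⟩
  refine hc.induction_on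
    (p := fun s => ∃ R : ℝ, 0 < R ∧ ∀ z ∈ s, z ∈ frontier Ω → TwoBallAt R Ω z) ?_ ?_ ?_ ?_
  · exact ⟨1, one_pos, by simp⟩
  · rintro s t hst ⟨R, hR, h⟩
    exact ⟨R, hR, fun z hz => h z (hst hz)⟩
  · rintro s t ⟨R, hR, h⟩ ⟨R', hR', h'⟩
    refine ⟨min R R', lt_min hR hR', ?_⟩
    rintro z (hz | hz) hzf
    · exact (h z hz hzf).mono (min_le_left _ _)
    · exact (h' z hz hzf).mono (min_le_right _ _)
  · intro x₀ hx₀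
    obtain ⟨r, hr, e, he, γ, ⟨hγ, L, hL⟩, hγS⟩ := hΩ x₀ hx₀
    refine ⟨Metric.ball x₀ (r / 2), mem_nhdsWithin_of_mem_nhds (Metric.ball_mem_nhds _ (by linarith)),
      min (r / 4) (1 / (2 * (L + 1))), by positivity, fun z hz hzf => ?_⟩
    exact twoBallAt_of_epigraph ho hr he
      (fun k hk => Submodule.mem_orthogonal_singleton_iff_inner_right.1 hk) hγ hL hγS hzf hz

end BallCondition

/-! ### Straightening the level sets of the signed distance -/

section Straightening

variable {V : Type*} [NormedAddCommGroup V] [InnerProductSpace ℝ V] [FiniteDimensional ℝ V]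

/-- `h` straightens the level sets of the signed distance of `S` in a ball about `x`. -/
structure Straightens (S : Set V) (R : ℝ) (x n : V) (h : V → V) (h' : V → V →L[ℝ] V) : Prop where
  norm_normal : ‖n‖ = 1
  hasFDerivAt : ∀ y ∈ Metric.ball x (R / 24), HasFDerivAt h (h' y) y
  injOn : Set.InjOn h (Metric.ball x (R / 24))
  sdist_eq : ∀ y, sdist S y = sdist S x + inner ℝ n (h y - x)
  norm_sub_le : ∀ y, ‖h y - y‖ ≤ ‖y - x‖ ^ 2 / R
  det_sub_le : ∀ y ∈ Metric.ball x (R / 24), |(h' y).det - 1| ≤ 6 / R * ‖y - x‖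
  ball_subset : Metric.ball x (R / 48) ⊆ h '' Metric.ball x (R / 24)

/-- The map adds the remainder of the expansion at `x` along `n`. Its derivative is the identity
plus a rank-one map of norm at most `|ν y - n| ≤ 6 / R * R / 24 = 1 / 4`, where `ν` is the gradient
of the signed distance; hence injectivity and the covered ball. -/
lemma TwoBall.exists_straightens {R : ℝ} {S : Set V} (hT : TwoBall R S) (hR : 0 < R)
    (hS : S.Nonempty) (hS' : Sᶜ.Nonempty) {x : V} (hx : |sdist S x| < R / 24) :
    ∃ n h h', Straightens S R x n h h' := by
  set B := Metric.ball x (R / 24) with hB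
  have hxB : x ∈ B := Metric.mem_ball_self (by positivity)
  have htube : ∀ y ∈ B, |sdist S y| < R / 2 := by
    intro y hy
    have h1 := abs_sdist_sub_le S y x
    rw [hB, Metric.mem_ball, dist_eq_norm] at hy
    have h2 := abs_add_le (sdist S y - sdist S x) (sdist S x)
    rw [sub_add_cancel] at h2
    linarith
  choose! ν hν1 hν using fun y (hy : |sdist S y| < R / 2) => hT.expansion hR hS hS' hy
  set n := ν x with hn
  have hn1 : ‖n‖ = 1 := hν1 x (htube x hxB)
  have hnn : inner ℝ n n = 1 := by rw [real_inner_self_eq_norm_sq, hn1, one_pow]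
  set h : V → V := fun y => y + (sdist S y - sdist S x - inner ℝ n (y - x)) • n with hh
  set A : V → V →L[ℝ] V := fun y => (innerSL ℝ (ν y - n)).smulRight n with hA
  have hA_norm : ∀ y ∈ B, ‖A y‖ ≤ 6 / R * ‖y - x‖ := by
    intro y hy
    rw [hA, ContinuousLinearMap.norm_smulRight_apply, hn1, mul_one, innerSL_apply_norm]
    exact norm_sub_le_of_expansion hR (hν x (htube x hxB)) (hν y (htube y hy))
  have hA_quarter : ∀ y ∈ B, ‖A y‖ ≤ 1 / 4 := by
    intro y hy
    refine (hA_norm y hy).trans ?_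
    rw [hB, Metric.mem_ball, dist_eq_norm] at hy
    calc 6 / R * ‖y - x‖ ≤ 6 / R * (R / 24) := by gcongr
      _ = 1 / 4 := by field_simp; norm_num
  set h' : V → V →L[ℝ] V := fun y => ContinuousLinearMap.id ℝ V + A y with hh'
  have hderiv : ∀ y ∈ B, HasFDerivAt h (h' y) y := by
    intro y hy
    have h1 : HasFDerivAt (sdist S) (innerSL ℝ (ν y)) y :=
      hasFDerivAt_of_expansion (hν y (htube y hy))
    have h2 : HasFDerivAt (fun y => inner ℝ n (y - x)) (innerSL ℝ n) y := by
      have := (innerSL ℝ n).hasFDerivAt (x := y - x)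
      exact this.comp y ((hasFDerivAt_id y).sub_const x)
    have h3 := ((h1.sub_const (sdist S x)).sub h2).smul_const n
    have h4 := (hasFDerivAt_id y).add h3
    change HasFDerivAt h (ContinuousLinearMap.id ℝ V + (innerSL ℝ (ν y - n)).smulRight n) y
    rw [map_sub]
    exact h4
  have happrox : ApproximatesLinearOn h (ContinuousLinearMap.id ℝ V) B (1 / 4 : ℝ≥0) := by
    intro a ha b hb
    have := Convex.norm_image_sub_le_of_norm_hasFDerivWithin_le' (f := h) (f' := h')
      (φ := ContinuousLinearMap.id ℝ V) (C := 1 / 4)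
      (fun y hy => (hderiv y hy).hasFDerivWithinAt)
      (fun y hy => by rw [hh']; simpa using hA_quarter y hy) (convex_ball _ _) hb ha
    simpa using this
  refine ⟨n, h, h', hn1, hderiv, ?_, fun y => ?_, fun y => ?_, fun y hy => ?_, ?_⟩
  · intro a ha b hb hab
    have := happrox a ha b hb
    rw [hab, sub_self, zero_sub, norm_neg] at this
    simp only [ContinuousLinearMap.coe_id', id_eq] at this
    have h0 : ‖a - b‖ ≤ 0 := by
      push_cast at this
      linarith
    exact sub_eq_zero.1 (norm_le_zero_iff.1 h0)
  · have : h y - x = (y - x) + (sdist S y - sdist S x - inner ℝ n (y - x)) • n := by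
      rw [hh]
      module
    rw [this, inner_add_right, inner_smul_right, hnn]
    ring
  · have : h y - y = (sdist S y - sdist S x - inner ℝ n (y - x)) • n := by
      rw [hh]
      module
    rw [this, norm_smul, hn1, mul_one]
    exact hν x (htube x hxB) y
  -- The derivative is a transvection, whose determinant is one plus the functional evaluated at the
  -- direction.
  · have : (h' y).det = 1 + inner ℝ (ν y - n) n := by
      exact LinearMap.transvection.det (innerSL ℝ (ν y - n) : V →ₗ[ℝ] ℝ) n
    rw [this, add_sub_cancel_left]
    refine (abs_real_inner_le_norm _ _).trans ?_
    rw [hn1, mul_one]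
    exact norm_sub_le_of_expansion hR (hν x (htube x hxB)) (hν y (htube y hy))
  · have hhx : h x = x := by simp [hh]
    let inv : (ContinuousLinearMap.id ℝ V).NonlinearRightInverse :=
      { toFun := id, nnnorm := 1, bound' := by simp, right_inv' := fun _ => rfl }
    have hsub : Metric.closedBall x (R / 36) ⊆ B :=
      Metric.closedBall_subset_ball (by linarith)
    have hsurj := happrox.surjOn_closedBall_of_nonlinearRightInverse inv
      (by positivity : (0 : ℝ) ≤ R / 36) hsub
    rw [hhx] at hsurj
    -- The surjectivity radius is `(1 - 1/4) * R / 36`; the radius `R / 36` keeps the closed ball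
    -- inside the open one of radius `R / 24`.
    have hrad : ((inv.nnnorm : ℝ)⁻¹ - ((1 / 4 : ℝ≥0) : ℝ)) * (R / 36) = R / 48 := by
      simp only [inv]
      push_cast
      ring
    rw [hrad] at hsurj
    exact Metric.ball_subset_closedBall.trans (hsurj.trans (Set.image_mono hsub))

end Straightening

/-! ### Powers of the norm integrated inside and outside a ball -/

section RadialIntegrals

/-- The surface measure of the unit sphere of `ℝ^N`. -/
def sphereArea (N : ℕ) : ℝ := N * volume.real (Metric.ball (0 : E N) 1)

variable {N : ℕ}

lemma pow_mul_rpow_sub {y b : ℝ} (hN : 0 < N) (hy : 0 < y) :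
    y ^ (N - 1) * y ^ (b - N) = y ^ (b - 1) := by
  rw [← Real.rpow_natCast, ← Real.rpow_add hy, Nat.cast_sub hN]
  congr 1
  push_cast
  ring

lemma integrableOn_norm_rpow_compl_ball (hN : 0 < N) {a r : ℝ} (ha : 0 < a) (hr : 0 < r) :
    IntegrableOn (fun v : E N => ‖v‖ ^ (-a - N)) (Metric.ball 0 r)ᶜ ∧
      ∫ v in (Metric.ball (0 : E N) r)ᶜ, ‖v‖ ^ (-a - N) = sphereArea N * (r ^ (-a) / a) := by
  have : Nonempty (Fin N) := ⟨⟨0, hN⟩⟩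
  have : Nontrivial (E N) := inferInstance
  set f : ℝ → ℝ := (Set.Ici r).indicator fun y => y ^ (-a - N) with hf
  have e1 : (Metric.ball (0 : E N) r)ᶜ.indicator (fun v => ‖v‖ ^ (-a - N)) = fun v => f ‖v‖ := by
    ext v
    by_cases h : r ≤ ‖v‖ <;> simp [hf, Set.indicator, h]
  have e2 : (fun y : ℝ => y ^ (N - 1) • f y) = (Set.Ici r).indicator fun y => y ^ (-a - 1) := by
    ext y
    by_cases h : r ≤ y
    · simp only [hf, Set.indicator, Set.mem_Ici, h, if_true, smul_eq_mul]
      exact pow_mul_rpow_sub hN (hr.trans_le h)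
    · simp [hf, Set.indicator, h]
  have hsub : Set.Ici r ∩ Set.Ioi 0 = Set.Ici r :=
    Set.inter_eq_left.2 fun y (hy : r ≤ y) => hr.trans_le hy
  have hI : IntegrableOn (fun y : ℝ => y ^ (-a - 1)) (Set.Ici r) := by
    rw [integrableOn_Ici_iff_integrableOn_Ioi]
    exact integrableOn_Ioi_rpow_of_lt (by linarith) hr
  have hfr : Module.finrank ℝ (E N) = N := by simp
  constructor
  · rw [← integrable_indicator_iff Metric.isOpen_ball.measurableSet.compl, e1,
      integrable_fun_norm_addHaar, hfr, e2]
    exact (hI.integrable_indicator measurableSet_Ici).integrableOn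
  · rw [← integral_indicator Metric.isOpen_ball.measurableSet.compl, e1,
      integral_fun_norm_addHaar, hfr, e2, setIntegral_indicator measurableSet_Ici, Set.inter_comm,
      hsub, integral_Ici_eq_integral_Ioi, integral_Ioi_rpow_of_lt (by linarith) hr]
    rw [sphereArea, nsmul_eq_mul, smul_eq_mul, mul_assoc]
    congr 2
    rw [show -a - 1 + 1 = -a by ring, neg_div_neg_eq]

lemma integrableOn_norm_rpow_ball (hN : 0 < N) {a r : ℝ} (ha : 0 < a) (hr : 0 < r) :
    IntegrableOn (fun v : E N => ‖v‖ ^ (a - N)) (Metric.ball 0 r) ∧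
      ∫ v in Metric.ball (0 : E N) r, ‖v‖ ^ (a - N) = sphereArea N * (r ^ a / a) := by
  have : Nonempty (Fin N) := ⟨⟨0, hN⟩⟩
  have : Nontrivial (E N) := inferInstance
  set f : ℝ → ℝ := (Set.Iio r).indicator fun y => y ^ (a - N) with hf
  have e1 : (Metric.ball (0 : E N) r).indicator (fun v => ‖v‖ ^ (a - N)) = fun v => f ‖v‖ := by
    ext v
    by_cases h : ‖v‖ < r <;> simp [hf, Set.indicator, h]
  have e2 : Set.EqOn (fun y : ℝ => y ^ (N - 1) • f y) ((Set.Iio r).indicator fun y => y ^ (a - 1))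
      (Set.Ioi 0) := by
    intro y hy
    by_cases h : y < r
    · simp only [hf, Set.indicator, Set.mem_Iio, h, if_true, smul_eq_mul]
      exact pow_mul_rpow_sub hN hy
    · simp [hf, Set.indicator, h]
  have hsub : Set.Ioi 0 ∩ Set.Iio r = Set.Ioo 0 r := rfl
  have hI : IntegrableOn (fun y : ℝ => y ^ (a - 1)) (Set.Ioo 0 r) :=
    (intervalIntegral.integrableOn_Ioo_rpow_iff hr).2 (by linarith)
  have hfr : Module.finrank ℝ (E N) = N := by simp
  constructor
  · rw [← integrable_indicator_iff Metric.isOpen_ball.measurableSet, e1,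
      integrable_fun_norm_addHaar, hfr, integrableOn_congr_fun e2 measurableSet_Ioi,
      ← integrable_indicator_iff measurableSet_Ioi, Set.indicator_indicator, hsub,
      integrable_indicator_iff measurableSet_Ioo]
    exact hI
  · rw [← integral_indicator Metric.isOpen_ball.measurableSet, e1,
      integral_fun_norm_addHaar, hfr, setIntegral_congr_fun measurableSet_Ioi e2,
      setIntegral_indicator measurableSet_Iio, hsub,
      ← integral_Ioc_eq_integral_Ioo, ← intervalIntegral.integral_of_le hr.le,
      integral_rpow (Or.inl (by linarith))]
    rw [sphereArea, nsmul_eq_mul, smul_eq_mul, mul_assoc, sub_add_cancel,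
      Real.zero_rpow ha.ne', sub_zero]

end RadialIntegrals

/-! ### Integrating out the directions tangent to a hyperplane -/

section Layers

/-- The integral of `(1 + ‖w‖²)^{-q/2}` over `ℝ^m`. -/
def layerConst (m : ℕ) (q : ℝ) : ℝ := ∫ w : E m, (1 + ‖w‖ ^ 2) ^ (-q / 2)

lemma layerConst_nonneg (m : ℕ) (q : ℝ) : 0 ≤ layerConst m q :=
  integral_nonneg fun w => by positivity

/-- Substituting `w = t w'` extracts the power of `|t|`; `q > m` makes the remaining integral
finite. -/
lemma lintegral_layer {m : ℕ} {q : ℝ} (hq : m < q) {t : ℝ} (ht : t ≠ 0) :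
    ∫⁻ w : E m, ENNReal.ofReal ((t ^ 2 + ‖w‖ ^ 2) ^ (-q / 2)) =
      ENNReal.ofReal (layerConst m q * |t| ^ (m - q)) := by
  have h0 : Integrable fun w : E m => (1 + ‖w‖ ^ 2) ^ (-q / 2) :=
    integrable_rpow_neg_one_add_norm_sq (by simpa using hq)
  have hfr : Module.finrank ℝ (E m) = m := by simp
  have ht' : 0 < |t| := abs_pos.2 ht
  have e : ∀ w : E m, (t ^ 2 + ‖w‖ ^ 2) ^ (-q / 2) =
      |t| ^ (-q) * (1 + ‖t⁻¹ • w‖ ^ 2) ^ (-q / 2) := by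
    intro w
    have h1 : t ^ 2 + ‖w‖ ^ 2 = |t| ^ (2 : ℝ) * (1 + ‖t⁻¹ • w‖ ^ 2) := by
      rw [norm_smul, norm_inv, mul_pow, Real.norm_eq_abs, Real.rpow_two, inv_pow, mul_add,
        mul_inv_cancel_left₀ (by positivity), sq_abs, mul_one]
    rw [h1, Real.mul_rpow (by positivity) (by positivity), ← Real.rpow_mul ht'.le]
    congr 2
    ring
  simp_rw [e]
  rw [← ofReal_integral_eq_lintegral_ofReal]
  · rw [integral_const_mul, Measure.integral_comp_inv_smul volume
      (fun w : E m => (1 + ‖w‖ ^ 2) ^ (-q / 2)), hfr, ← layerConst, smul_eq_mul, abs_pow,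
      ← Real.rpow_natCast, sub_eq_add_neg, Real.rpow_add ht']
    congr 1
    ring
  · exact (h0.comp_smul (inv_ne_zero ht)).const_mul _
  · exact Filter.Eventually.of_forall fun v => by positivity

/-- Integration over `ℝ^{m+1}` of a function of one coordinate against a power of the norm. -/
lemma lintegral_inner_mul_norm_rpow {m : ℕ} {q : ℝ} (hq : m < q) {n : E (m + 1)} (hn : ‖n‖ = 1)
    {g : ℝ → ℝ≥0∞} (hg : Measurable g) :
    ∫⁻ z : E (m + 1), g (inner ℝ n z) * ENNReal.ofReal (‖z‖ ^ (-q)) =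
      ENNReal.ofReal (layerConst m q) * ∫⁻ t, g t * ENNReal.ofReal (|t| ^ (m - q)) := by
  -- A rotation makes `n` the zeroth coordinate vector; Fubini then integrates the other `m`
  -- coordinates for each height `t ≠ 0`.
  obtain ⟨b, hb⟩ := Orthonormal.exists_orthonormalBasis_extension_of_card_eq (𝕜 := ℝ)
    (E := E (m + 1)) (ι := Fin (m + 1)) (by simp) (v := fun _ => n) (s := {0}) (by
      constructor
      · intro i
        simpa using hn
      · intro i j hij
        exact absurd (Subsingleton.elim i j) hij)
  have hb0 : b 0 = n := hb 0 rfl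
  have hmeas : Measurable fun w : E (m + 1) => g (w 0) * ENNReal.ofReal (‖w‖ ^ (-q)) := by
    fun_prop
  have s1 : ∫⁻ z : E (m + 1), g (inner ℝ n z) * ENNReal.ofReal (‖z‖ ^ (-q)) =
      ∫⁻ w : E (m + 1), g (w 0) * ENNReal.ofReal (‖w‖ ^ (-q)) := by
    rw [← b.measurePreserving_repr.lintegral_comp hmeas]
    refine lintegral_congr fun z => ?_
    rw [b.repr_apply_apply, hb0, b.repr.norm_map]
  have s2 : ∫⁻ w : E (m + 1), g (w 0) * ENNReal.ofReal (‖w‖ ^ (-q)) =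
      ∫⁻ w : Fin (m + 1) → ℝ, g (w 0) * ENNReal.ofReal ((∑ i, w i ^ 2) ^ (-q / 2)) := by
    rw [← (EuclideanSpace.volume_preserving_symm_measurableEquiv_toLp (Fin (m + 1))).lintegral_comp
      (by fun_prop)]
    refine lintegral_congr fun z => ?_
    congr 2
    rw [EuclideanSpace.norm_eq, Real.sqrt_eq_rpow, ← Real.rpow_mul (by positivity)]
    simp only [Real.norm_eq_abs, sq_abs]
    congr 1
    ring
  have s3 : ∫⁻ w : Fin (m + 1) → ℝ, g (w 0) * ENNReal.ofReal ((∑ i, w i ^ 2) ^ (-q / 2)) =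
      ∫⁻ z : ℝ × (Fin m → ℝ), g z.1 *
        ENNReal.ofReal ((z.1 ^ 2 + ∑ i, z.2 i ^ 2) ^ (-q / 2)) := by
    rw [← (volume_preserving_piFinSuccAbove (fun _ : Fin (m + 1) => ℝ) 0).lintegral_comp
      (by fun_prop)]
    refine lintegral_congr fun z => ?_
    rw [Fin.sum_univ_succ]
    rfl
  rw [s1, s2, s3, Measure.volume_eq_prod, lintegral_prod _ (by fun_prop),
    ← lintegral_const_mul _ (by fun_prop)]
  have hne : ∀ᵐ t : ℝ, t ≠ 0 := by simp [ae_iff]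
  refine lintegral_congr_ae ?_
  filter_upwards [hne] with t ht
  rw [lintegral_const_mul _ (by fun_prop), mul_left_comm,
    ← ENNReal.ofReal_mul (layerConst_nonneg _ _), ← lintegral_layer hq ht]
  congr 1
  rw [← (EuclideanSpace.volume_preserving_symm_measurableEquiv_toLp (Fin m)).lintegral_comp
      (by fun_prop)]
  refine lintegral_congr fun z => ?_
  congr 2
  rw [EuclideanSpace.norm_sq_eq]
  simp

lemma integral_inner_mul_norm_rpow {m : ℕ} {q : ℝ} (hq : m < q) {n : E (m + 1)} (hn : ‖n‖ = 1)
    {g : ℝ → ℝ} (hg : Measurable g)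
    (h1 : Integrable fun z : E (m + 1) => g (inner ℝ n z) * ‖z‖ ^ (-q))
    (h2 : Integrable fun t => g t * |t| ^ (m - q)) :
    ∫ z : E (m + 1), g (inner ℝ n z) * ‖z‖ ^ (-q) =
      layerConst m q * ∫ t, g t * |t| ^ (m - q) := by
  have key : ∀ f : ℝ → ℝ, Measurable f →
      (∫⁻ z : E (m + 1), ENNReal.ofReal (f (inner ℝ n z) * ‖z‖ ^ (-q))).toReal =
      layerConst m q * (∫⁻ t, ENNReal.ofReal (f t * |t| ^ (m - q))).toReal := by
    intro f hf
    have := lintegral_inner_mul_norm_rpow hq hn (g := fun t => ENNReal.ofReal (f t)) (by fun_prop)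
    simp_rw [← ENNReal.ofReal_mul' (Real.rpow_nonneg (norm_nonneg _) _),
      ← ENNReal.ofReal_mul' (Real.rpow_nonneg (abs_nonneg _) _)] at this
    rw [this, ENNReal.toReal_mul, ENNReal.toReal_ofReal (layerConst_nonneg _ _)]
  rw [integral_eq_lintegral_pos_part_sub_lintegral_neg_part h1,
    integral_eq_lintegral_pos_part_sub_lintegral_neg_part h2, key g hg, mul_sub]
  simp_rw [← neg_mul]
  rw [key (fun t => -g t) hg.neg]

end Layers

/-! ### The cut-off and the exact one-dimensional computation -/

section Profile

lemma abs_spow {x q : ℝ} (hq : 0 < q) : |spow x q| = |x| ^ q := by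
  unfold spow
  rcases eq_or_ne x 0 with rfl | hx
  · simp [Real.zero_rpow hq.ne']
  · rw [abs_mul, abs_of_nonneg (Real.rpow_nonneg (abs_nonneg x) _)]
    nth_rewrite 2 [← Real.rpow_one |x|]
    rw [← Real.rpow_add (abs_pos.2 hx), sub_add_cancel]

lemma spow_neg (x q : ℝ) : spow (-x) q = -spow x q := by simp [spow]

lemma spow_zero (q : ℝ) : spow 0 q = 0 := by simp [spow]

lemma spow_of_pos {x q : ℝ} (hx : 0 < x) : spow x q = x ^ q := by
  rw [spow, abs_of_pos hx]
  nth_rewrite 2 [← Real.rpow_one x]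
  rw [← Real.rpow_add hx, sub_add_cancel]

lemma measurable_spow (q : ℝ) : Measurable fun x => spow x q := by
  unfold spow
  fun_prop

lemma abs_rpow_sub_rpow_le {s a b : ℝ} (hs0 : 0 < s) (hs1 : s < 1) (ha : 0 ≤ a) (hb : 0 ≤ b) :
    |a ^ s - b ^ s| ≤ |a - b| ^ s := by
  wlog h : b ≤ a generalizing a b
  · rw [abs_sub_comm, abs_sub_comm a b]
    exact this hb ha (not_le.1 h).le
  have h1 : b ^ s ≤ a ^ s := by gcongr
  rw [abs_of_nonneg (sub_nonneg.2 h1), abs_of_nonneg (sub_nonneg.2 h)]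
  have := Real.rpow_add_le_add_rpow (sub_nonneg.2 h) hb hs0.le hs1.le
  rw [sub_add_cancel] at this
  linarith

/-- The signed power of `a ^ s - b ^ s`, cut off where `a` and `b` are close to each other relative
to their size. -/
def profile (s p κ a b : ℝ) : ℝ :=
  if b ≤ κ * a ∨ a ≤ κ * b then spow (a ^ s - b ^ s) (p - 1) else 0

variable {s p κ : ℝ}

lemma profile_swap (a b : ℝ) : profile s p κ b a = -profile s p κ a b := by
  unfold profile
  rw [if_congr (or_comm (a := a ≤ κ * b)) rfl rfl, ← neg_sub, spow_neg]
  split_ifs <;> simp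

lemma abs_spow_rpow_sub_le (hs0 : 0 < s) (hs1 : s < 1) (hp : 1 < p) {a b : ℝ} (ha : 0 ≤ a)
    (hb : 0 ≤ b) : |spow (a ^ s - b ^ s) (p - 1)| ≤ |a - b| ^ (s * (p - 1)) := by
  rw [abs_spow (by linarith), Real.rpow_mul (abs_nonneg _)]
  have := abs_rpow_sub_rpow_le hs0 hs1 ha hb
  have : 0 ≤ p - 1 := by linarith
  gcongr

lemma abs_profile_le_abs_spow (a b : ℝ) :
    |profile s p κ a b| ≤ |spow (a ^ s - b ^ s) (p - 1)| := by
  unfold profile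
  split_ifs
  · exact le_rfl
  · simp

lemma abs_profile_le (hs0 : 0 < s) (hs1 : s < 1) (hp : 1 < p) {a b : ℝ} (ha : 0 ≤ a)
    (hb : 0 ≤ b) : |profile s p κ a b| ≤ |a - b| ^ (s * (p - 1)) :=
  (abs_profile_le_abs_spow a b).trans (abs_spow_rpow_sub_le hs0 hs1 hp ha hb)

/-- The cut-off therefore vanishes near the singularity of the kernel. The second branch of the
condition is excluded because `κ (2 - κ) < 1`. -/
lemma profile_eq_zero (hκ0 : 0 < κ) (hκ1 : κ < 1) {a b : ℝ}
    (h : |a - b| < (1 - κ) * a) : profile s p κ a b = 0 := by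
  unfold profile
  rw [abs_lt] at h
  rw [if_neg]
  push Not
  constructor
  · linarith
  · nlinarith

lemma measurable_profile : Measurable fun z : ℝ × ℝ => profile s p κ z.1 z.2 := by
  unfold profile
  refine Measurable.ite ?_ ?_ measurable_const
  · exact (measurableSet_le measurable_snd (measurable_fst.const_mul κ)).union
      (measurableSet_le measurable_fst (measurable_snd.const_mul κ))
  · exact (measurable_spow _).comp (by fun_prop)

/-- For `a ≠ b` the cut-off is eventually inactive; for `a = b` both sides are zero. -/
lemma tendsto_profile (a b : ℝ) {κ : ℕ → ℝ}
    (hκ : Filter.Tendsto κ Filter.atTop (nhds 1)) :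
    Filter.Tendsto (fun k => profile s p (κ k) a b) Filter.atTop
      (nhds (spow (a ^ s - b ^ s) (p - 1))) := by
  rcases lt_trichotomy a b with h | h | h
  · refine tendsto_const_nhds.congr' ?_
    have : Filter.Tendsto (fun k => κ k * b) Filter.atTop (nhds (1 * b)) := hκ.mul_const b
    filter_upwards [this.eventually (lt_mem_nhds (show a < 1 * b by linarith))] with k hk
    rw [profile, if_pos (Or.inr hk.le)]
  · subst h
    simp [profile, spow_zero]
  · refine tendsto_const_nhds.congr' ?_
    have : Filter.Tendsto (fun k => κ k * a) Filter.atTop (nhds (1 * a)) := hκ.mul_const a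
    filter_upwards [this.eventually (lt_mem_nhds (show b < 1 * a by linarith))] with k hk
    rw [profile, if_pos (Or.inl hk.le)]

/-- Homogeneity holds because the cut-off is by the ratio of its arguments, not by their distance.
-/
lemma profile_mul {d : ℝ} (hd : 0 < d) {t : ℝ} (ht : 0 ≤ t) :
    profile s p κ d (d * t) = d ^ (s * (p - 1)) * profile s p κ 1 t := by
  have h1 : d * t ≤ κ * d ↔ t ≤ κ * 1 := by
    rw [mul_comm κ d, mul_le_mul_iff_right₀ hd, mul_one]
  have h2 : d ≤ κ * (d * t) ↔ 1 ≤ κ * t := by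
    rw [mul_left_comm]
    exact le_mul_iff_one_le_right hd
  have h3 : d ^ s - (d * t) ^ s = d ^ s * (1 ^ s - t ^ s) := by
    rw [Real.mul_rpow hd.le ht, Real.one_rpow]
    ring
  unfold profile
  rw [if_congr (or_congr h1 h2) rfl rfl, h3]
  split_ifs
  · rw [spow, spow, abs_mul, abs_of_pos (Real.rpow_pos_of_pos hd s),
      Real.mul_rpow (by positivity) (abs_nonneg _), Real.rpow_mul hd.le]
    nth_rewrite 2 [← Real.rpow_one (d ^ s)]
    have := Real.rpow_add (Real.rpow_pos_of_pos hd s) (p - 1 - 1) 1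
    rw [sub_add_cancel] at this
    rw [this]
    ring
  · simp

/-- The value of the truncated one-dimensional operator at `t_+ ^ s` is a multiple of this. -/
def profileDefect (s p κ : ℝ) : ℝ := (1 - κ ^ s) ^ p * (1 - κ) ^ (-(p * s))

lemma profileDefect_nonneg (hs0 : 0 < s) (hκ0 : 0 < κ) (hκ1 : κ < 1) :
    0 ≤ profileDefect s p κ := by
  have h1 : κ ^ s ≤ 1 := Real.rpow_le_one hκ0.le hκ1.le hs0.le
  have h2 : 0 ≤ 1 - κ ^ s := by linarith
  have h3 : 0 ≤ 1 - κ := by linarith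
  unfold profileDefect
  positivity

/-- `κ ≤ κ ^ s` bounds `1 - κ ^ s` by `1 - κ`. The exponent left over is positive since `s < 1`, so
the defect disappears in the limit. -/
lemma profileDefect_le (hs0 : 0 < s) (hs1 : s < 1) (hp : 1 < p) (hκ0 : 0 < κ) (hκ1 : κ < 1) :
    profileDefect s p κ ≤ (1 - κ) ^ (p * (1 - s)) := by
  have h1 : κ ^ s ≤ 1 := Real.rpow_le_one hκ0.le hκ1.le hs0.le
  have h2 : κ ≤ κ ^ s := by
    nth_rewrite 1 [← Real.rpow_one κ]
    exact Real.rpow_le_rpow_of_exponent_ge hκ0 hκ1.le hs1.le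
  have h3 : 0 < 1 - κ := by linarith
  calc profileDefect s p κ ≤ (1 - κ) ^ p * (1 - κ) ^ (-(p * s)) := by
        unfold profileDefect
        gcongr
    _ = (1 - κ) ^ (p * (1 - s)) := by
        rw [← Real.rpow_add h3]
        congr 1
        ring

lemma profileDefect_le_one (hs0 : 0 < s) (hs1 : s < 1) (hp : 1 < p) (hκ0 : 0 < κ) (hκ1 : κ < 1) :
    profileDefect s p κ ≤ 1 :=
  (profileDefect_le hs0 hs1 hp hκ0 hκ1).trans
    (Real.rpow_le_one (by linarith) (by linarith) (mul_nonneg (by linarith) (by linarith)))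

lemma tendsto_profileDefect (hs0 : 0 < s) (hs1 : s < 1) (hp : 1 < p) {κ : ℕ → ℝ}
    (hκ0 : ∀ k, 0 < κ k) (hκ1 : ∀ k, κ k < 1)
    (hκ : Filter.Tendsto κ Filter.atTop (nhds 1)) :
    Filter.Tendsto (fun k => profileDefect s p (κ k)) Filter.atTop (nhds 0) := by
  have he : 0 < p * (1 - s) := mul_pos (by linarith) (by linarith)
  have h1 : Filter.Tendsto (fun k => (1 - κ k) ^ (p * (1 - s))) Filter.atTop (nhds 0) := by
    have := (hκ.const_sub 1).rpow_const (p := p * (1 - s)) (Or.inr he.le)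
    rwa [sub_self, Real.zero_rpow he.ne'] at this
  exact squeeze_zero (fun k => profileDefect_nonneg hs0 (hκ0 k) (hκ1 k))
    (fun k => profileDefect_le hs0 hs1 hp (hκ0 k) (hκ1 k)) h1

/-- The reason the exponent `s` is special: once `(0, 1)` and `(1, ∞)` are folded together by `t ↦
1/t`, the one-dimensional integrand is an exact derivative. -/
lemma hasDerivAt_profileDefect (hs0 : 0 < s) {t : ℝ} (ht0 : 0 < t) (ht1 : t < 1) :
    HasDerivAt (fun t => (1 - t ^ s) ^ p * (1 - t) ^ (-(p * s)))
      (p * s * ((1 - t ^ s) ^ (p - 1) * (1 - t) ^ (-1 - p * s) * (1 - t ^ (s - 1)))) t := by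
  have h1 : 0 < 1 - t ^ s := by
    have := Real.rpow_lt_one ht0.le ht1 hs0
    linarith
  have h2 : 0 < 1 - t := by linarith
  have d1 := ((Real.hasDerivAt_rpow_const (p := s) (Or.inl ht0.ne')).const_sub 1).rpow_const
    (p := p) (Or.inl h1.ne')
  have d2 := ((hasDerivAt_id t).const_sub 1).rpow_const (p := -(p * s)) (Or.inl h2.ne')
  refine (d1.mul d2).congr_deriv ?_
  simp only [id]
  have e1 : (1 - t ^ s) ^ p = (1 - t ^ s) ^ (p - 1) * (1 - t ^ s) := by
    rw [Real.rpow_sub_one h1.ne', div_mul_cancel₀ _ h1.ne']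
  have e2 : (1 - t) ^ (-(p * s)) = (1 - t) ^ (-1 - p * s) * (1 - t) := by
    rw [show -1 - p * s = -(p * s) - 1 by ring, Real.rpow_sub_one h2.ne', div_mul_cancel₀ _ h2.ne']
  have e3 : t ^ s = t ^ (s - 1) * t := by
    rw [Real.rpow_sub_one ht0.ne', div_mul_cancel₀ _ ht0.ne']
  rw [e2, e1, show -(p * s) - 1 = -1 - p * s by ring]
  generalize (1 - t) ^ (-1 - p * s) = A
  generalize (1 - t ^ s) ^ (p - 1) = B
  rw [e3]
  ring

lemma integral_profile_aux (hs0 : 0 < s) (hp : 1 < p) (hκ0 : 0 < κ) (hκ1 : κ < 1) :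
    IntegrableOn (fun t : ℝ => (1 - t ^ s) ^ (p - 1) * (1 - t) ^ (-1 - p * s)) (Set.Ioc 0 κ) ∧
    IntegrableOn (fun t : ℝ => (1 - t ^ s) ^ (p - 1) * (1 - t) ^ (-1 - p * s) * t ^ (s - 1))
      (Set.Ioc 0 κ) ∧
    ∫ t in Set.Ioc 0 κ, (1 - t ^ s) ^ (p - 1) * (1 - t) ^ (-1 - p * s) * (1 - t ^ (s - 1)) =
      (profileDefect s p κ - 1) / (p * s) := by
  have hps : 0 < p * s := by positivity
  have hpos : ∀ t ∈ Set.Icc 0 κ, 0 ≤ 1 - t ^ s ∧ 1 - t ≠ 0 := by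
    intro t ht
    have := Real.rpow_le_one ht.1 (ht.2.trans hκ1.le) hs0.le
    exact ⟨by linarith, by linarith [ht.2]⟩
  have hcs : Continuous fun t : ℝ => 1 - t ^ s :=
    continuous_const.sub (Real.continuous_rpow_const hs0.le)
  have hc1 : ContinuousOn (fun t : ℝ => (1 - t ^ s) ^ (p - 1) * (1 - t) ^ (-1 - p * s))
      (Set.Icc 0 κ) := by
    refine ContinuousOn.mul ?_ ?_
    · exact (hcs.rpow_const fun t => Or.inr (by linarith)).continuousOn
    · exact ContinuousOn.rpow_const (by fun_prop) fun t ht => Or.inl (hpos t ht).2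
  have hc2 : ContinuousOn (fun t : ℝ => (1 - t ^ s) ^ p * (1 - t) ^ (-(p * s)))
      (Set.Icc 0 κ) := by
    refine ContinuousOn.mul ?_ ?_
    · exact (hcs.rpow_const fun t => Or.inr (by linarith)).continuousOn
    · exact ContinuousOn.rpow_const (by fun_prop) fun t ht => Or.inl (hpos t ht).2
  have hi1 : IntervalIntegrable (fun t : ℝ => (1 - t ^ s) ^ (p - 1) * (1 - t) ^ (-1 - p * s))
      volume 0 κ := by
    rw [← Set.uIcc_of_le hκ0.le] at hc1
    exact hc1.intervalIntegrable
  have hi2 : IntervalIntegrable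
      (fun t : ℝ => (1 - t ^ s) ^ (p - 1) * (1 - t) ^ (-1 - p * s) * t ^ (s - 1)) volume 0 κ := by
    rw [← Set.uIcc_of_le hκ0.le] at hc1
    exact (intervalIntegral.intervalIntegrable_rpow' (by linarith)).continuousOn_mul hc1
  have hi3 : IntervalIntegrable
      (fun t : ℝ => p * s * ((1 - t ^ s) ^ (p - 1) * (1 - t) ^ (-1 - p * s) * (1 - t ^ (s - 1))))
      volume 0 κ := by
    refine ((hi1.sub hi2).const_mul (p * s)).congr ?_
    exact fun t _ => by ring
  refine ⟨(intervalIntegrable_iff_integrableOn_Ioc_of_le hκ0.le).1 hi1,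
    (intervalIntegrable_iff_integrableOn_Ioc_of_le hκ0.le).1 hi2, ?_⟩
  -- Continuity up to the endpoints suffices: at `0` the derivative may blow up, but only like the
  -- integrable `t ^ (s - 1)`.
  have hF := intervalIntegral.integral_eq_sub_of_hasDerivAt_of_le hκ0.le hc2
    (fun t ht => hasDerivAt_profileDefect hs0 ht.1 (ht.2.trans hκ1)) hi3
  rw [intervalIntegral.integral_const_mul, intervalIntegral.integral_of_le hκ0.le] at hF
  rw [eq_div_iff hps.ne', mul_comm, hF]
  simp [profileDefect, Real.zero_rpow hs0.ne']

lemma integral_Iic_one_sub_rpow (hps : 0 < p * s) :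
    Integrable ((Set.Iic (0 : ℝ)).indicator fun t => (1 - t) ^ (-1 - p * s)) ∧
      ∫ t, (Set.Iic (0 : ℝ)).indicator (fun t => (1 - t) ^ (-1 - p * s)) t = 1 / (p * s) := by
  set H : ℝ → ℝ := (Set.Ici 1).indicator fun y => y ^ (-1 - p * s) with hH
  have e : (Set.Iic (0 : ℝ)).indicator (fun t => (1 - t) ^ (-1 - p * s)) = fun t => H (1 - t) := by
    ext t
    by_cases h : t ≤ 0 <;> simp [hH, Set.indicator, h]
  have hi : IntegrableOn (fun y : ℝ => y ^ (-1 - p * s)) (Set.Ici 1) := by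
    rw [integrableOn_Ici_iff_integrableOn_Ioi]
    exact integrableOn_Ioi_rpow_of_lt (by linarith) one_pos
  rw [e]
  refine ⟨(hi.integrable_indicator measurableSet_Ici).comp_sub_left 1, ?_⟩
  rw [integral_sub_left_eq_self, hH, integral_indicator measurableSet_Ici,
    integral_Ici_eq_integral_Ioi, integral_Ioi_rpow_of_lt (by linarith) one_pos, Real.one_rpow,
    show -1 - p * s + 1 = -(p * s) by ring, neg_div_neg_eq]

/-- The substitution `t ↦ 1/t` carries `[1/κ, ∞)` to `(0, κ]`; the powers of `t` combine to `t ^ (s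
- 1)`. -/
lemma integral_Ici_inversion (hs0 : 0 < s) (hp : 1 < p) (hκ0 : 0 < κ) (hκ1 : κ < 1) :
    Integrable ((Set.Ici κ⁻¹).indicator
      fun t => -((t ^ s - 1) ^ (p - 1) * (t - 1) ^ (-1 - p * s))) ∧
    ∫ t, (Set.Ici κ⁻¹).indicator (fun t => -((t ^ s - 1) ^ (p - 1) * (t - 1) ^ (-1 - p * s))) t =
      -∫ t in Set.Ioc 0 κ, (1 - t ^ s) ^ (p - 1) * (1 - t) ^ (-1 - p * s) * t ^ (s - 1) := by
  set G : ℝ → ℝ := (Set.Ici κ⁻¹).indicator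
    fun t => -((t ^ s - 1) ^ (p - 1) * (t - 1) ^ (-1 - p * s)) with hG
  have hsupp : ∀ t, t ∉ Set.Ioi (0 : ℝ) → G t = 0 := by
    intro t ht
    rw [hG, Set.indicator_of_notMem]
    intro (h : κ⁻¹ ≤ t)
    exact ht (lt_of_lt_of_le (inv_pos.2 hκ0) h)
  have e : Set.EqOn (fun x : ℝ => (|(-1 : ℝ)| * x ^ ((-1 : ℝ) - 1)) • G (x ^ (-1 : ℝ)))
      ((Set.Ioc 0 κ).indicator
        fun t => -((1 - t ^ s) ^ (p - 1) * (1 - t) ^ (-1 - p * s) * t ^ (s - 1)))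
      (Set.Ioi 0) := by
    intro x (hx : 0 < x)
    simp only [Real.rpow_neg_one, abs_neg, abs_one, one_mul, smul_eq_mul]
    by_cases h : x ≤ κ
    · have h1 : κ⁻¹ ≤ x⁻¹ := inv_anti₀ hx h
      have hx1 : x < 1 := h.trans_lt hκ1
      have h2 : 0 < 1 - x ^ s := by
        have := Real.rpow_lt_one hx.le hx1 hs0
        linarith
      have e1 : x⁻¹ ^ s - 1 = (1 - x ^ s) * x ^ (-s) := by
        rw [Real.inv_rpow hx.le, Real.rpow_neg hx.le]
        have : 0 < x ^ s := Real.rpow_pos_of_pos hx s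
        field_simp
      have e2 : x⁻¹ - 1 = (1 - x) * x ^ (-1 : ℝ) := by
        rw [Real.rpow_neg_one]
        field_simp
      rw [hG, Set.indicator_of_mem (show x⁻¹ ∈ Set.Ici κ⁻¹ from h1),
        Set.indicator_of_mem (show x ∈ Set.Ioc 0 κ from ⟨hx, h⟩), e1, e2,
        Real.mul_rpow h2.le (by positivity), Real.mul_rpow (by linarith) (by positivity),
        ← Real.rpow_mul hx.le, ← Real.rpow_mul hx.le]
      have e3 : x ^ (s - 1) = x ^ ((-1 : ℝ) - 1) * x ^ (-s * (p - 1)) * x ^ (-1 * (-1 - p * s)) := by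
        rw [← Real.rpow_add hx, ← Real.rpow_add hx]
        congr 1
        ring
      rw [e3]
      ring
    · rw [hG, Set.indicator_of_notMem, Set.indicator_of_notMem, mul_zero]
      · exact fun h' => h h'.2
      · exact fun h' => h ((inv_le_inv₀ hκ0 hx).1 h')
  obtain ⟨-, h2, -⟩ := integral_profile_aux hs0 hp hκ0 hκ1
  have hsub : Set.Ioi (0 : ℝ) ∩ Set.Ioc 0 κ = Set.Ioc 0 κ :=
    Set.inter_eq_right.2 fun x hx => hx.1
  constructor
  · have : IntegrableOn G (Set.Ioi 0) := by
      rw [← integrableOn_Ioi_comp_rpow_iff G (neg_ne_zero.2 one_ne_zero : (-1 : ℝ) ≠ 0),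
        integrableOn_congr_fun e measurableSet_Ioi]
      exact (h2.neg.integrable_indicator measurableSet_Ioc).integrableOn
    rwa [integrableOn_iff_integrable_of_support_subset] at this
    intro t ht
    by_contra h
    exact ht (hsupp t h)
  · rw [← setIntegral_eq_integral_of_forall_compl_eq_zero hsupp,
      ← integral_comp_rpow_Ioi G (neg_ne_zero.2 one_ne_zero : (-1 : ℝ) ≠ 0),
      setIntegral_congr_fun measurableSet_Ioi e, setIntegral_indicator measurableSet_Ioc, hsub,
      integral_neg]

/-- The cut-off leaves `(-∞, 0]`, `(0, κ]` and `[1/κ, ∞)`. The last two together give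
`(profileDefect - 1) / (p s)`, and the half-line where `t_+` vanishes contributes exactly the
missing `1 / (p s)`. -/
lemma integral_profile_one (hs0 : 0 < s) (hp : 1 < p) (hκ0 : 0 < κ) (hκ1 : κ < 1) :
    Integrable (fun t => profile s p κ 1 (max t 0) * |t - 1| ^ (-1 - p * s)) ∧
      ∫ t, profile s p κ 1 (max t 0) * |t - 1| ^ (-1 - p * s) =
        profileDefect s p κ / (p * s) := by
  have hps : 0 < p * s := by positivity
  obtain ⟨i1, v1⟩ := integral_Iic_one_sub_rpow hps
  obtain ⟨i2, i2', v2⟩ := integral_profile_aux hs0 hp hκ0 hκ1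
  obtain ⟨i3, v3⟩ := integral_Ici_inversion hs0 hp hκ0 hκ1
  have i2i := i2.integrable_indicator measurableSet_Ioc
  have e : (fun t => profile s p κ 1 (max t 0) * |t - 1| ^ (-1 - p * s)) =
      fun t => (Set.Iic (0 : ℝ)).indicator (fun t => (1 - t) ^ (-1 - p * s)) t +
        (Set.Ioc 0 κ).indicator (fun t => (1 - t ^ s) ^ (p - 1) * (1 - t) ^ (-1 - p * s)) t +
        (Set.Ici κ⁻¹).indicator (fun t => -((t ^ s - 1) ^ (p - 1) * (t - 1) ^ (-1 - p * s))) t := by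
    ext t
    have hκi : 1 < κ⁻¹ := (one_lt_inv₀ hκ0).2 hκ1
    rcases le_or_gt t 0 with h | h
    · rw [Set.indicator_of_mem (show t ∈ Set.Iic 0 from h),
        Set.indicator_of_notMem (fun h' : t ∈ Set.Ioc 0 κ => absurd h'.1 (not_lt.2 h)),
        Set.indicator_of_notMem (fun h' : t ∈ Set.Ici κ⁻¹ => by
          rw [Set.mem_Ici] at h'
          linarith), max_eq_right h, profile, if_pos (Or.inl (by positivity)),
        Real.one_rpow, Real.zero_rpow hs0.ne', sub_zero, spow_of_pos one_pos, Real.one_rpow,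
        abs_sub_comm, abs_of_nonneg (by linarith)]
      ring
    rw [Set.indicator_of_notMem (show t ∉ Set.Iic 0 from not_le.2 h), max_eq_left h.le, zero_add]
    rcases le_or_gt t κ with h1 | h1
    · have h2 : 0 < 1 - t ^ s := by
        have := Real.rpow_lt_one h.le (h1.trans_lt hκ1) hs0
        linarith
      rw [Set.indicator_of_mem (show t ∈ Set.Ioc 0 κ from ⟨h, h1⟩),
        Set.indicator_of_notMem (fun h' : t ∈ Set.Ici κ⁻¹ => by
          rw [Set.mem_Ici] at h'
          linarith), profile, if_pos (Or.inl (by linarith)), Real.one_rpow, spow_of_pos h2,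
        abs_sub_comm, abs_of_nonneg (by linarith), add_zero]
    rw [Set.indicator_of_notMem (fun h' : t ∈ Set.Ioc 0 κ => absurd h'.2 (not_le.2 h1)), zero_add]
    have hiff : κ⁻¹ ≤ t ↔ 1 ≤ κ * t := by
      rw [inv_le_iff_one_le_mul₀' hκ0]
    rcases le_or_gt κ⁻¹ t with h2 | h2
    · have h3 : 0 < t ^ s - 1 := by
        have := Real.one_lt_rpow (hκi.trans_le h2) hs0
        linarith
      rw [Set.indicator_of_mem (show t ∈ Set.Ici κ⁻¹ from h2), profile,
        if_pos (Or.inr (hiff.1 h2)), Real.one_rpow, ← neg_sub, spow_neg, spow_of_pos h3,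
        abs_of_nonneg (by linarith), neg_mul]
    · rw [Set.indicator_of_notMem (show t ∉ Set.Ici κ⁻¹ from not_le.2 h2), profile, if_neg, zero_mul]
      push Not
      exact ⟨by linarith, not_le.1 fun h3 => absurd (hiff.2 h3) (not_le.2 h2)⟩
  rw [e]
  refine ⟨(i1.add i2i).add i3, ?_⟩
  have a1 := integral_add (i1.add i2i) i3
  have a2 := integral_add i1 i2i
  simp only [Pi.add_apply] at a1
  rw [a1, a2, v1, v3, integral_indicator measurableSet_Ioc,
    add_assoc, ← sub_eq_add_neg, ← integral_sub i2 i2']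
  simp_rw [mul_sub, mul_one] at v2
  rw [v2]
  ring

/-- Scaling from `d = 1`: the profile gives `d ^ (s (p - 1))`, the kernel `d ^ (-1 - p s)` and the
measure `d`, in all `d ^ (-s)`. -/
lemma integral_profile (hs0 : 0 < s) (hp : 1 < p) (hκ0 : 0 < κ) (hκ1 : κ < 1) {d : ℝ}
    (hd : 0 < d) :
    Integrable (fun t => profile s p κ d (max (d + t) 0) * |t| ^ (-1 - p * s)) ∧
      ∫ t, profile s p κ d (max (d + t) 0) * |t| ^ (-1 - p * s) =
        d ^ (-s) * (profileDefect s p κ / (p * s)) := by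
  obtain ⟨h1, h2⟩ := integral_profile_one hs0 hp hκ0 hκ1
  set G : ℝ → ℝ := fun t => profile s p κ 1 (max t 0) * |t - 1| ^ (-1 - p * s) with hG
  have e : (fun t => profile s p κ d (max (d + t) 0) * |t| ^ (-1 - p * s)) =
      fun t => d ^ (s * (p - 1) + (-1 - p * s)) * G (d⁻¹ * (d + t)) := by
    ext t
    have e1 : max (d + t) 0 = d * max (d⁻¹ * (d + t)) 0 := by
      rw [mul_max_of_nonneg _ _ hd.le, mul_zero, mul_inv_cancel_left₀ hd.ne']
    have e2 : |t| = d * |d⁻¹ * (d + t) - 1| := by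
      nth_rewrite 1 [← abs_of_pos hd]
      rw [← abs_mul, mul_sub, mul_inv_cancel_left₀ hd.ne']
      congr 1
      ring
    rw [e1, profile_mul hd (le_max_right _ _)]
    rw [e2, Real.mul_rpow hd.le (abs_nonneg _), Real.rpow_add hd, hG]
    ring
  have h3 : Integrable fun t => G (d⁻¹ * (d + t)) :=
    (h1.comp_mul_left' (inv_ne_zero hd.ne')).comp_add_left d
  rw [e]
  refine ⟨h3.const_mul _, ?_⟩
  rw [integral_const_mul, integral_add_left_eq_self (fun t => G (d⁻¹ * t)) d,
    Measure.integral_comp_mul_left, h2, inv_inv, abs_of_pos hd, smul_eq_mul, ← mul_assoc]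
  congr 1
  nth_rewrite 2 [← Real.rpow_one d]
  rw [← Real.rpow_add hd]
  congr 1
  ring

end Profile

/-! ### The radial integrals about an arbitrary centre -/

section TranslatedRadial

variable {N : ℕ}

lemma integrableOn_norm_sub_rpow_compl_ball (hN : 0 < N) {a r : ℝ} (ha : 0 < a) (hr : 0 < r)
    (x : E N) :
    IntegrableOn (fun y : E N => ‖y - x‖ ^ (-a - N)) (Metric.ball x r)ᶜ ∧
      ∫ y in (Metric.ball x r)ᶜ, ‖y - x‖ ^ (-a - N) = sphereArea N * (r ^ (-a) / a) := by
  obtain ⟨h1, h2⟩ := integrableOn_norm_rpow_compl_ball hN ha hr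
  have e : (Metric.ball x r)ᶜ.indicator (fun y : E N => ‖y - x‖ ^ (-a - N)) =
      fun y => (Metric.ball (0 : E N) r)ᶜ.indicator (fun v : E N => ‖v‖ ^ (-a - N)) (y - x) := by
    ext y
    by_cases h : ‖y - x‖ < r <;> simp [Set.indicator, dist_eq_norm, h]
  rw [← integrable_indicator_iff Metric.isOpen_ball.measurableSet.compl] at h1 ⊢
  rw [← integral_indicator Metric.isOpen_ball.measurableSet.compl] at h2 ⊢
  rw [e]
  exact ⟨h1.comp_sub_right x, by rw [integral_sub_right_eq_self, h2]⟩

lemma integrableOn_norm_sub_rpow_ball (hN : 0 < N) {a r : ℝ} (ha : 0 < a) (hr : 0 < r)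
    (x : E N) :
    IntegrableOn (fun y : E N => ‖y - x‖ ^ (a - N)) (Metric.ball x r) ∧
      ∫ y in Metric.ball x r, ‖y - x‖ ^ (a - N) = sphereArea N * (r ^ a / a) := by
  obtain ⟨h1, h2⟩ := integrableOn_norm_rpow_ball hN ha hr
  have e : (Metric.ball x r).indicator (fun y : E N => ‖y - x‖ ^ (a - N)) =
      fun y => (Metric.ball (0 : E N) r).indicator (fun v : E N => ‖v‖ ^ (a - N)) (y - x) := by
    ext y
    by_cases h : ‖y - x‖ < r <;> simp [Set.indicator, dist_eq_norm, h]
  rw [← integrable_indicator_iff Metric.isOpen_ball.measurableSet] at h1 ⊢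
  rw [← integral_indicator Metric.isOpen_ball.measurableSet] at h2 ⊢
  rw [e]
  exact ⟨h1.comp_sub_right x, by rw [integral_sub_right_eq_self, h2]⟩

end TranslatedRadial

/-! ### The kernel against its pullback -/

section Kernel

lemma abs_rpow_neg_sub_le {q a b : ℝ} (hq : 0 < q) (ha : 0 < a) (hb : a / 2 ≤ b) :
    |a ^ (-q) - b ^ (-q)| ≤ q * 2 ^ (q + 1) * a ^ (-q - 1) * |a - b| := by
  have h := Convex.norm_image_sub_le_of_norm_hasDerivWithin_le (f := fun t : ℝ => t ^ (-q))
    (f' := fun t => -q * t ^ (-q - 1)) (s := Set.Ici (a / 2)) (x := b) (y := a)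
    (C := q * 2 ^ (q + 1) * a ^ (-q - 1)) (fun t ht => ?_) (fun t ht => ?_) (convex_Ici _) hb
    (show a / 2 ≤ a by linarith)
  · simpa only [Real.norm_eq_abs] using h
  · have ht' : 0 < t := lt_of_lt_of_le (by linarith) ht
    exact (Real.hasDerivAt_rpow_const (Or.inl ht'.ne')).hasDerivWithinAt
  · have ht' : a / 2 ≤ t := ht
    have ht0 : 0 < t := lt_of_lt_of_le (by linarith) ht
    have h1 : t ^ (-q - 1) ≤ (a / 2) ^ (-q - 1) :=
      Real.rpow_le_rpow_of_nonpos (by linarith) ht' (by linarith)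
    have h2 : (a / 2) ^ (-q - 1) = 2 ^ (q + 1) * a ^ (-q - 1) := by
      rw [Real.div_rpow ha.le two_pos.le, show -q - 1 = -(q + 1) by ring,
        Real.rpow_neg two_pos.le, div_inv_eq_mul, mul_comm]
    rw [norm_mul, norm_neg, Real.norm_of_nonneg hq.le, Real.norm_of_nonneg (by positivity),
      mul_assoc, ← h2]
    gcongr

/-- The constant in the comparison of the kernel with its pullback under a straightening. -/
def kernelConst (q R : ℝ) : ℝ := (q * 2 ^ (q + 1) + 6 * 2 ^ q) / R

lemma kernelConst_nonneg {q R : ℝ} (hq : 0 < q) (hR : 0 < R) : 0 ≤ kernelConst q R := by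
  unfold kernelConst
  positivity

/-- Straightening changes the norm by `|y - x|² / R` and the volume by a factor `1 + O(|y - x| /
R)`. Both are relative errors of order `|y - x| / R`, whence the gain of one power. -/
lemma Straightens.abs_kernel_sub_le {V : Type*} [NormedAddCommGroup V] [InnerProductSpace ℝ V]
    {S : Set V} {R q : ℝ} {x n : V} {h : V → V} {h' : V → V →L[ℝ] V}
    (hst : Straightens S R x n h h') (hR : 0 < R) (hq : 0 < q) {y : V}
    (hy : y ∈ Metric.ball x (R / 24)) :
    |‖y - x‖ ^ (-q) - |(h' y).det| * ‖h y - x‖ ^ (-q)| ≤ kernelConst q R * ‖y - x‖ ^ (1 - q) := by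
  have hsub := hst.norm_sub_le y
  have hyR : ‖y - x‖ < R / 24 := by rwa [Metric.mem_ball, dist_eq_norm] at hy
  have hdet := hst.det_sub_le y hy
  -- At the centre both negative powers are `0` by the convention `0 ^ c = 0` for `c ≠ 0`.
  rcases (norm_nonneg (y - x)).eq_or_lt with h0 | ha
  · rw [← h0] at hsub ⊢
    have hyx : y = x := by rw [← sub_eq_zero, ← norm_eq_zero, h0]
    have : h y - x = 0 := by
      rw [← norm_le_zero_iff]
      rw [hyx] at hsub ⊢
      simpa using hsub
    rw [this, norm_zero, Real.zero_rpow (by linarith), mul_zero, sub_zero, abs_zero]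
    exact mul_nonneg (kernelConst_nonneg hq hR) (Real.rpow_nonneg le_rfl _)
  have h3' : abs (1 - |(h' y).det|) ≤ 6 / R * ‖y - x‖ := by
    rw [abs_sub_comm]
    have := abs_abs_sub_abs_le_abs_sub (h' y).det 1
    rw [abs_one] at this
    exact this.trans hdet
  set J := |(h' y).det|
  set a := ‖y - x‖ with hadef
  set b := ‖h y - x‖ with hbdef
  have hab : |a - b| ≤ a ^ 2 / R := by
    refine le_trans ?_ hsub
    rw [abs_sub_comm]
    have := abs_norm_sub_norm_le (h y - x) (y - x)
    rwa [sub_sub_sub_cancel_right] at this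
  have hsmall : a ^ 2 / R ≤ a / 24 := by
    rw [div_le_iff₀ hR]
    nlinarith
  have hb : a / 2 ≤ b := by
    have := (abs_le.1 (hab.trans hsmall)).2
    linarith
  have h1 := abs_rpow_neg_sub_le hq ha hb
  have h2 : b ^ (-q) ≤ 2 ^ q * a ^ (-q) := by
    refine (Real.rpow_le_rpow_of_nonpos (by linarith) hb (by linarith)).trans (le_of_eq ?_)
    rw [Real.div_rpow ha.le two_pos.le, Real.rpow_neg two_pos.le, div_inv_eq_mul, mul_comm]
  have h4 : a ^ (-q) - J * b ^ (-q) =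
      (a ^ (-q) - b ^ (-q)) + (1 - J) * b ^ (-q) := by ring
  have e1 : a ^ (1 - q) = a ^ (-q) * a := by
    rw [show 1 - q = -q + 1 by ring, Real.rpow_add ha, Real.rpow_one]
  have e2 : a ^ (-q - 1) = a ^ (-q) / a := by rw [Real.rpow_sub ha, Real.rpow_one]
  rw [h4]
  refine (abs_add_le _ _).trans ?_
  have hbq : 0 ≤ b ^ (-q) := Real.rpow_nonneg (norm_nonneg _) _
  rw [abs_mul, abs_of_nonneg hbq]
  calc |a ^ (-q) - b ^ (-q)| + |1 - J| * b ^ (-q)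
      ≤ q * 2 ^ (q + 1) * a ^ (-q - 1) * (a ^ 2 / R) + 6 / R * a * (2 ^ q * a ^ (-q)) := by
        gcongr
        exact h1.trans (by gcongr)
    _ = kernelConst q R * a ^ (1 - q) := by
        rw [e1, e2, kernelConst]
        field_simp

end Kernel

/-! ### Comparison of the domain with the tangent half-space -/

section Comparison

variable {N : ℕ} {S : Set (E N)} {R s p d : ℝ} {x n : E N} {h : E N → E N}
  {h' : E N → E N →L[ℝ] E N}

/-- The bound on layer profiles under which the comparison with the half-space holds. -/
structure IsProfile (s p d : ℝ) (G : ℝ → ℝ) : Prop where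
  measurable : Measurable G
  abs_le : ∀ t, |G t| ≤ |max t 0 - d| ^ (s * (p - 1))

/-- The difference of the nonlocal operators in `S` and in the half-space tangent at the level of
`x`, for a layer profile `G`. -/
def comparisonError (S : Set (E N)) (R q d : ℝ) (x n : E N) (h : E N → E N)
    (h' : E N → E N →L[ℝ] E N) (G : ℝ → ℝ) : ℝ :=
  (∫ y in (Metric.ball x (R / 24))ᶜ, G (sdist S y) * ‖y - x‖ ^ (-q)) +
    (∫ y in Metric.ball x (R / 24),
      G (sdist S y) * (‖y - x‖ ^ (-q) - |(h' y).det| * ‖h y - x‖ ^ (-q))) -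
    ∫ z in (h '' Metric.ball x (R / 24))ᶜ, G (d + inner ℝ n (z - x)) * ‖z - x‖ ^ (-q)

lemma IsProfile.abs_sdist_le {G : ℝ → ℝ} (hG : IsProfile s p d G) (hs0 : 0 < s) (hp : 1 < p)
    (hd : 0 < d) (hdx : sdist S x = d) (y : E N) :
    |G (sdist S y)| ≤ ‖y - x‖ ^ (s * (p - 1)) := by
  refine (hG.abs_le _).trans ?_
  have hσ : 0 ≤ s * (p - 1) := mul_nonneg hs0.le (by linarith)
  gcongr
  have h1 := (Metric.lipschitz_infDist_pt Sᶜ).dist_le_mul y x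
  have hx : d = max (sdist S x) 0 := by rw [hdx, max_eq_left hd.le]
  rw [hx, max_sdist, max_sdist]
  simpa [Real.dist_eq, dist_eq_norm] using h1

lemma IsProfile.abs_inner_le {G : ℝ → ℝ} (hG : IsProfile s p d G) (hs0 : 0 < s) (hp : 1 < p)
    (hd : 0 < d) (hn : ‖n‖ = 1) (z : E N) :
    |G (d + inner ℝ n (z - x))| ≤ ‖z - x‖ ^ (s * (p - 1)) := by
  refine (hG.abs_le _).trans ?_
  have hσ : 0 ≤ s * (p - 1) := mul_nonneg hs0.le (by linarith)
  gcongr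
  have h1 : |max (d + inner ℝ n (z - x)) 0 - max d 0| ≤ |d + inner ℝ n (z - x) - d| :=
    abs_max_sub_max_le_abs _ _ _
  rw [max_eq_left hd.le, add_sub_cancel_left] at h1
  refine h1.trans ((abs_real_inner_le_norm _ _).trans ?_)
  rw [hn, one_mul]

lemma abs_mul_rpow_le {r g b c e : ℝ} (hr : 0 ≤ r) (hc : c ≠ 0) (hg : |g| ≤ r ^ b)
    (he : b + c = e) : |g * r ^ c| ≤ r ^ e := by
  rw [abs_mul, abs_of_nonneg (Real.rpow_nonneg hr c)]
  rcases hr.eq_or_lt with h | h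
  · rw [← h, Real.zero_rpow hc, mul_zero]
    exact Real.rpow_nonneg le_rfl _
  · rw [← he, Real.rpow_add h]
    gcongr

lemma Straightens.aemeasurable_kernel (hst : Straightens S R x n h h') (q : ℝ) :
    AEMeasurable (fun y => |(h' y).det| * ‖h y - x‖ ^ (-q))
      (volume.restrict (Metric.ball x (R / 24))) := by
  have h1 := aemeasurable_toNNReal_abs_det_fderivWithin volume Metric.isOpen_ball.measurableSet
    fun y hy => (hst.hasFDerivAt y hy).hasFDerivWithinAt
  have h2 : AEMeasurable (fun y => |(h' y).det|) (volume.restrict (Metric.ball x (R / 24))) := by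
    refine h1.coe_nnreal_real.congr (Filter.Eventually.of_forall fun y => ?_)
    exact Real.coe_toNNReal _ (abs_nonneg _)
  have h3 : AEMeasurable h (volume.restrict (Metric.ball x (R / 24))) :=
    ContinuousOn.aemeasurable
      (fun y hy => (hst.hasFDerivAt y hy).continuousAt.continuousWithinAt)
      Metric.isOpen_ball.measurableSet
  fun_prop

lemma Straightens.measurableSet_image (hst : Straightens S R x n h h') :
    MeasurableSet (h '' Metric.ball x (R / 24)) :=
  measurable_image_of_fderivWithin Metric.isOpen_ball.measurableSet
    (fun y hy => (hst.hasFDerivAt y hy).hasFDerivWithinAt) hst.injOn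

lemma IsProfile.measurable_sdist_mul {G : ℝ → ℝ} (hG : IsProfile s p d G) (q : ℝ) :
    Measurable fun y => G (sdist S y) * ‖y - x‖ ^ (-q) := by
  have := hG.measurable
  have := (continuous_sdist S).measurable
  fun_prop

lemma IsProfile.measurable_inner_mul {G : ℝ → ℝ} (hG : IsProfile s p d G) (q : ℝ) :
    Measurable fun z => G (d + inner ℝ n (z - x)) * ‖z - x‖ ^ (-q) := by
  have := hG.measurable
  fun_prop

lemma IsProfile.abs_sdist_mul_le {G : ℝ → ℝ} (hG : IsProfile s p d G) (hs0 : 0 < s)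
    (hp : 1 < p) (hd : 0 < d) (hdx : sdist S x = d) (y : E N) :
    ‖G (sdist S y) * ‖y - x‖ ^ (-(N + p * s))‖ ≤ ‖y - x‖ ^ (-s - N) := by
  refine abs_mul_rpow_le (norm_nonneg _) ?_ (hG.abs_sdist_le hs0 hp hd hdx y) (by ring)
  have : 0 < p * s := by positivity
  exact neg_ne_zero.2 (by positivity)

lemma IsProfile.abs_inner_mul_le {G : ℝ → ℝ} (hG : IsProfile s p d G) (hs0 : 0 < s)
    (hp : 1 < p) (hd : 0 < d) (hn : ‖n‖ = 1) (z : E N) :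
    ‖G (d + inner ℝ n (z - x)) * ‖z - x‖ ^ (-(N + p * s))‖ ≤ ‖z - x‖ ^ (-s - N) := by
  refine abs_mul_rpow_le (norm_nonneg _) ?_ (hG.abs_inner_le hs0 hp hd hn z) (by ring)
  have : 0 < p * s := by positivity
  exact neg_ne_zero.2 (by positivity)

/-- The exponents add up as `s (p - 1) + 1 - (N + p s) = 1 - s - N`, integrable at the centre
exactly because `s < 1`. -/
lemma IsProfile.abs_kernel_mul_le {G : ℝ → ℝ} (hG : IsProfile s p d G) (hs0 : 0 < s)
    (hp : 1 < p) (hd : 0 < d) (hdx : sdist S x = d) (hR : 0 < R)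
    (hst : Straightens S R x n h h') {y : E N} (hy : y ∈ Metric.ball x (R / 24)) :
    ‖G (sdist S y) * (‖y - x‖ ^ (-(N + p * s)) - |(h' y).det| * ‖h y - x‖ ^ (-(N + p * s)))‖ ≤
      kernelConst (N + p * s) R * ‖y - x‖ ^ (1 - s - N) := by
  have hps : 0 < p * s := by positivity
  have hq : 0 < N + p * s := by positivity
  have h1 := hst.abs_kernel_sub_le hR hq hy
  have h2 := hG.abs_sdist_le hs0 hp hd hdx y
  have hC := kernelConst_nonneg hq hR
  rw [norm_mul, Real.norm_eq_abs, Real.norm_eq_abs]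
  rcases (norm_nonneg (y - x)).eq_or_lt with h0 | h0
  · have h3 : G (sdist S y) = 0 := by
      rw [← abs_nonpos_iff]
      rwa [← h0, Real.zero_rpow (mul_pos hs0 (by linarith)).ne'] at h2
    rw [h3, abs_zero, zero_mul]
    positivity
  · calc _ ≤ ‖y - x‖ ^ (s * (p - 1)) * (kernelConst (N + p * s) R * ‖y - x‖ ^ (1 - (N + p * s))) := by
          gcongr
      _ = kernelConst (N + p * s) R *
          (‖y - x‖ ^ (s * (p - 1)) * ‖y - x‖ ^ (1 - (N + p * s))) := by ring
      _ = _ := by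
          rw [← Real.rpow_add h0]
          congr 2
          ring

/-- The uniform bound for `comparisonError`. -/
def errorConst (N : ℕ) (s p R : ℝ) : ℝ :=
  sphereArea N * ((R / 24) ^ (-s) / s) +
    kernelConst (N + p * s) R * (sphereArea N * ((R / 24) ^ (1 - s) / (1 - s))) +
    sphereArea N * ((R / 48) ^ (-s) / s)

/-- The bound is free of `d` and `G`, hence uniform up to the boundary and in the truncation. The
last term is controlled because the image of the ball covers `B(x, R / 48)`. -/
lemma Straightens.abs_comparisonError_le (hst : Straightens S R x n h h') (hN : 0 < N)
    (hs0 : 0 < s) (hs1 : s < 1) (hp : 1 < p) (hR : 0 < R) (hd : 0 < d) (hdx : sdist S x = d)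
    {G : ℝ → ℝ} (hG : IsProfile s p d G) :
    |comparisonError S R (N + p * s) d x n h h' G| ≤ errorConst N s p R := by
  obtain ⟨i1, v1⟩ := integrableOn_norm_sub_rpow_compl_ball hN hs0 (by positivity : 0 < R / 24) x
  obtain ⟨i2, v2⟩ := integrableOn_norm_sub_rpow_ball hN (by linarith : 0 < 1 - s)
    (by positivity : 0 < R / 24) x
  obtain ⟨i3, v3⟩ := integrableOn_norm_sub_rpow_compl_ball hN hs0 (by positivity : 0 < R / 48) x
  have hsub : (h '' Metric.ball x (R / 24))ᶜ ⊆ (Metric.ball x (R / 48))ᶜ :=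
    Set.compl_subset_compl.2 hst.ball_subset
  have b1 := norm_integral_le_of_norm_le i1
    (Filter.Eventually.of_forall fun y => hG.abs_sdist_mul_le hs0 hp hd hdx y)
  have b2 := norm_integral_le_of_norm_le (i2.const_mul (kernelConst (N + p * s) R))
    (ae_restrict_of_forall_mem Metric.isOpen_ball.measurableSet
      fun y hy => hG.abs_kernel_mul_le hs0 hp hd hdx hR hst hy)
  have b3 := norm_integral_le_of_norm_le (i3.mono_set hsub)
    (Filter.Eventually.of_forall fun y => hG.abs_inner_mul_le hs0 hp hd hst.norm_normal y)
  have b4 := setIntegral_mono_set i3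
    (Filter.Eventually.of_forall fun y => by positivity) hsub.eventuallyLE
  rw [v1] at b1
  rw [integral_const_mul, v2] at b2
  rw [v3] at b4
  rw [Real.norm_eq_abs] at b1 b2 b3
  unfold comparisonError errorConst
  refine (abs_sub _ _).trans ?_
  refine add_le_add ((abs_add_le _ _).trans (add_le_add b1 b2)) (b3.trans b4)

/-- The majorants behind the uniform bound do not depend on the profile, so dominated convergence
applies to each of the three integrals. -/
lemma Straightens.tendsto_comparisonError (hst : Straightens S R x n h h') (hN : 0 < N)
    (hs0 : 0 < s) (hs1 : s < 1) (hp : 1 < p) (hR : 0 < R) (hd : 0 < d) (hdx : sdist S x = d)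
    {G : ℕ → ℝ → ℝ} {G' : ℝ → ℝ} (hG : ∀ k, IsProfile s p d (G k))
    (hlim : ∀ t, Filter.Tendsto (fun k => G k t) Filter.atTop (nhds (G' t))) :
    Filter.Tendsto (fun k => comparisonError S R (N + p * s) d x n h h' (G k)) Filter.atTop
      (nhds (comparisonError S R (N + p * s) d x n h h' G')) := by
  obtain ⟨i1, v1⟩ := integrableOn_norm_sub_rpow_compl_ball hN hs0 (by positivity : 0 < R / 24) x
  obtain ⟨i2, v2⟩ := integrableOn_norm_sub_rpow_ball hN (by linarith : 0 < 1 - s)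
    (by positivity : 0 < R / 24) x
  obtain ⟨i3, v3⟩ := integrableOn_norm_sub_rpow_compl_ball hN hs0 (by positivity : 0 < R / 48) x
  have hsub : (h '' Metric.ball x (R / 24))ᶜ ⊆ (Metric.ball x (R / 48))ᶜ :=
    Set.compl_subset_compl.2 hst.ball_subset
  refine ((tendsto_integral_of_dominated_convergence _ (fun k => ?_) i1 (fun k => ?_) ?_).add
    (tendsto_integral_of_dominated_convergence _ (fun k => ?_)
      (i2.const_mul (kernelConst (N + p * s) R)) (fun k => ?_) ?_)).sub
    (tendsto_integral_of_dominated_convergence _ (fun k => ?_) (i3.mono_set hsub) (fun k => ?_) ?_)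
  · exact ((hG k).measurable_sdist_mul _).aestronglyMeasurable
  · exact Filter.Eventually.of_forall fun y => (hG k).abs_sdist_mul_le hs0 hp hd hdx y
  · exact Filter.Eventually.of_forall fun y => (hlim _).mul_const _
  · have m1 := (hG k).measurable
    have m2 := (continuous_sdist S).measurable
    have m3 := hst.aemeasurable_kernel (N + p * s)
    refine AEMeasurable.aestronglyMeasurable ?_
    refine AEMeasurable.mul (by fun_prop) (AEMeasurable.sub (by fun_prop) m3)
  · exact ae_restrict_of_forall_mem Metric.isOpen_ball.measurableSet
      fun y hy => (hG k).abs_kernel_mul_le hs0 hp hd hdx hR hst hy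
  · exact Filter.Eventually.of_forall fun y => (hlim _).mul_const _
  · exact ((hG k).measurable_inner_mul _).aestronglyMeasurable
  · exact Filter.Eventually.of_forall fun y =>
      (hG k).abs_inner_mul_le hs0 hp hd hst.norm_normal y
  · exact Filter.Eventually.of_forall fun y => (hlim _).mul_const _

lemma integrable_of_abs_le_of_eq_zero (hN : 0 < N) (hs0 : 0 < s) {η : ℝ} (hη : 0 < η)
    {F : E N → ℝ} (hF : Measurable F) (hle : ∀ y, ‖F y‖ ≤ ‖y - x‖ ^ (-s - N))
    (hzero : ∀ y, ‖y - x‖ < η → F y = 0) :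
    Integrable F ∧ ∫ y, ‖F y‖ ≤ sphereArea N * (η ^ (-s) / s) := by
  obtain ⟨i1, v1⟩ := integrableOn_norm_sub_rpow_compl_ball hN hs0 hη x
  have hi := i1.integrable_indicator Metric.isOpen_ball.measurableSet.compl
  have hb : ∀ y, ‖F y‖ ≤ (Metric.ball x η)ᶜ.indicator (fun y => ‖y - x‖ ^ (-s - N)) y := by
    intro y
    by_cases hy : ‖y - x‖ < η
    · rw [hzero y hy, norm_zero]
      exact Set.indicator_nonneg (fun _ _ => by positivity) _
    · rw [Set.indicator_of_mem (by rwa [Set.mem_compl_iff, Metric.mem_ball, dist_eq_norm])]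
      exact hle y
  have hFi := hi.mono' hF.aestronglyMeasurable (Filter.Eventually.of_forall hb)
  refine ⟨hFi, ?_⟩
  rw [← v1, ← integral_indicator Metric.isOpen_ball.measurableSet.compl]
  exact integral_mono hFi.norm hi hb

lemma IsProfile.integrable_sdist_mul (hN : 0 < N) (hs0 : 0 < s) (hp : 1 < p) (hd : 0 < d)
    (hdx : sdist S x = d) {G : ℝ → ℝ} (hG : IsProfile s p d G) {η : ℝ} (hη : 0 < η)
    (hzero : ∀ t, |max t 0 - d| < η → G t = 0) :
    Integrable (fun y => G (sdist S y) * ‖y - x‖ ^ (-(N + p * s))) ∧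
      ∫ y, ‖G (sdist S y) * ‖y - x‖ ^ (-(N + p * s))‖ ≤ sphereArea N * (η ^ (-s) / s) := by
  refine integrable_of_abs_le_of_eq_zero hN hs0 hη (hG.measurable_sdist_mul _)
    (hG.abs_sdist_mul_le hs0 hp hd hdx) fun y hy => ?_
  rw [hzero, zero_mul]
  refine lt_of_le_of_lt ?_ hy
  have h1 := (Metric.lipschitz_infDist_pt Sᶜ).dist_le_mul y x
  have hx : d = max (sdist S x) 0 := by rw [hdx, max_eq_left hd.le]
  rw [hx, max_sdist, max_sdist]
  simpa [Real.dist_eq, dist_eq_norm] using h1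

lemma IsProfile.integrable_inner_mul (hN : 0 < N) (hs0 : 0 < s) (hp : 1 < p) (hd : 0 < d)
    (hn : ‖n‖ = 1) {G : ℝ → ℝ} (hG : IsProfile s p d G) {η : ℝ} (hη : 0 < η)
    (hzero : ∀ t, |max t 0 - d| < η → G t = 0) :
    Integrable fun z => G (d + inner ℝ n (z - x)) * ‖z - x‖ ^ (-(N + p * s)) := by
  refine (integrable_of_abs_le_of_eq_zero hN hs0 hη (hG.measurable_inner_mul _)
    (hG.abs_inner_mul_le hs0 hp hd hn) fun y hy => ?_).1
  rw [hzero, zero_mul]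
  refine lt_of_le_of_lt ?_ hy
  have h1 : |max (d + inner ℝ n (y - x)) 0 - max d 0| ≤ |d + inner ℝ n (y - x) - d| :=
    abs_max_sub_max_le_abs _ _ _
  rw [max_eq_left hd.le, add_sub_cancel_left] at h1
  refine h1.trans ((abs_real_inner_le_norm _ _).trans ?_)
  rw [hn, one_mul]

/-- Change of variables `z = h y` on the small ball. Vanishing of `G` near `d` makes the singular
integrals absolutely convergent, so that they may be subtracted. -/
lemma Straightens.integral_eq (hst : Straightens S R x n h h') (hN : 0 < N)
    (hs0 : 0 < s) (hp : 1 < p) (hd : 0 < d) (hdx : sdist S x = d)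
    {G : ℝ → ℝ} (hG : IsProfile s p d G) {η : ℝ} (hη : 0 < η)
    (hzero : ∀ t, |max t 0 - d| < η → G t = 0) :
    ∫ y, G (sdist S y) * ‖y - x‖ ^ (-(N + p * s)) =
      comparisonError S R (N + p * s) d x n h h' G +
        ∫ z, G (d + inner ℝ n (z - x)) * ‖z - x‖ ^ (-(N + p * s)) := by
  set q : ℝ := N + p * s
  set B := Metric.ball x (R / 24)
  have hB : MeasurableSet B := Metric.isOpen_ball.measurableSet
  obtain ⟨i1, -⟩ := hG.integrable_sdist_mul hN hs0 hp hd hdx hη hzero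
  have i2 : Integrable fun z => G (d + inner ℝ n (z - x)) * ‖z - x‖ ^ (-q) :=
    hG.integrable_inner_mul hN hs0 hp hd hst.norm_normal hη hzero
  have hder : ∀ y ∈ B, HasFDerivWithinAt h (h' y) B y :=
    fun y hy => (hst.hasFDerivAt y hy).hasFDerivWithinAt
  have hpull : ∀ y, |(h' y).det| • (G (d + inner ℝ n (h y - x)) * ‖h y - x‖ ^ (-q)) =
      G (sdist S y) * (|(h' y).det| * ‖h y - x‖ ^ (-q)) := by
    intro y
    rw [hst.sdist_eq y, hdx, smul_eq_mul]
    ring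
  have c1 := integral_image_eq_integral_abs_det_fderiv_smul volume hB hder hst.injOn
    fun z => G (d + inner ℝ n (z - x)) * ‖z - x‖ ^ (-q)
  have c2 := (integrableOn_image_iff_integrableOn_abs_det_fderiv_smul volume hB hder hst.injOn
    fun z => G (d + inner ℝ n (z - x)) * ‖z - x‖ ^ (-q)).1 i2.integrableOn
  simp_rw [hpull] at c1 c2
  rw [← integral_add_compl hB i1, ← integral_add_compl hst.measurableSet_image i2, c1,
    comparisonError]
  simp_rw [mul_sub]
  rw [integral_sub i1.integrableOn c2]
  ring

end Comparison

/-! ### The truncated operator and its limit -/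

section Truncation

variable {N : ℕ} {Ω : Set (E N)} {R s p κ : ℝ} {x : E N}

/-- The truncated fractional `p`-Laplacian of `δ ^ s`, up to a factor `2`. -/
def truncOp (s p κ : ℝ) (Ω : Set (E N)) (x : E N) : ℝ :=
  ∫ y, profile s p κ (delta Ω x) (delta Ω y) / ‖x - y‖ ^ ((N : ℝ) + p * s)

lemma max_sdist_eq_delta (Ω : Set (E N)) (x : E N) : max (sdist Ω x) 0 = delta Ω x :=
  max_sdist Ω x

lemma sdist_eq_delta (hx : x ∈ Ω) : sdist Ω x = delta Ω x := sdist_of_mem hx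

lemma delta_nonneg (Ω : Set (E N)) (x : E N) : 0 ≤ delta Ω x := Metric.infDist_nonneg

lemma continuous_delta (Ω : Set (E N)) : Continuous (delta Ω) := Metric.continuous_infDist_pt _

lemma delta_eq_zero (hx : x ∉ Ω) : delta Ω x = 0 :=
  Metric.infDist_zero_of_mem (show x ∈ Ωᶜ from hx)

lemma delta_pos (ho : IsOpen Ω) (hne : Ωᶜ.Nonempty) (hx : x ∈ Ω) : 0 < delta Ω x :=
  (ho.isClosed_compl.notMem_iff_infDist_pos hne).1 (by simpa using hx)

lemma abs_delta_sub_le (Ω : Set (E N)) (x y : E N) : |delta Ω x - delta Ω y| ≤ ‖x - y‖ := by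
  have := (Metric.lipschitz_infDist_pt Ωᶜ).dist_le_mul x y
  simpa [delta, Real.dist_eq, dist_eq_norm] using this

lemma isProfile_profile (hs0 : 0 < s) (hs1 : s < 1) (hp : 1 < p) {d : ℝ} (hd : 0 ≤ d) :
    IsProfile s p d fun t => profile s p κ d (max t 0) where
  measurable := measurable_profile.comp (by fun_prop : Measurable fun t : ℝ => (d, max t 0))
  abs_le t := by
    rw [abs_sub_comm]
    exact abs_profile_le hs0 hs1 hp hd (le_max_right _ _)

lemma isProfile_spow (hs0 : 0 < s) (hs1 : s < 1) (hp : 1 < p) {d : ℝ} (hd : 0 ≤ d) :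
    IsProfile s p d fun t => spow (d ^ s - max t 0 ^ s) (p - 1) where
  measurable := (measurable_spow _).comp (by fun_prop)
  abs_le t := by
    rw [abs_sub_comm]
    exact abs_spow_rpow_sub_le hs0 hs1 hp hd (le_max_right _ _)

lemma profile_eq_zero_of_abs_max_sub_lt (hκ0 : 0 < κ) (hκ1 : κ < 1) {d : ℝ} (t : ℝ)
    (ht : |max t 0 - d| < (1 - κ) * d) : profile s p κ d (max t 0) = 0 := by
  rw [abs_sub_comm] at ht
  exact profile_eq_zero hκ0 hκ1 ht

lemma profile_delta_div_eq (hx : x ∈ Ω) (y : E N) :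
    profile s p κ (delta Ω x) (delta Ω y) / ‖x - y‖ ^ ((N : ℝ) + p * s) =
      profile s p κ (sdist Ω x) (max (sdist Ω y) 0) * ‖y - x‖ ^ (-(N + p * s)) := by
  rw [max_sdist_eq_delta, sdist_eq_delta hx, norm_sub_rev, Real.rpow_neg (norm_nonneg _),
    div_eq_mul_inv]

/-- Where the cut-off is active, `y` is at distance at least `(1 - κ) δ(x)` from `x`. The resulting
`δ(x) ^ (-s)` is what Hardy's inequality later absorbs. -/
lemma integrable_profile_delta (hN : 0 < N) (hs0 : 0 < s) (hs1 : s < 1) (hp : 1 < p)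
    (hκ0 : 0 < κ) (hκ1 : κ < 1) (ho : IsOpen Ω) (hne : Ωᶜ.Nonempty) (hx : x ∈ Ω) :
    Integrable (fun y => profile s p κ (delta Ω x) (delta Ω y) / ‖x - y‖ ^ ((N : ℝ) + p * s)) ∧
      ∫ y, ‖profile s p κ (delta Ω x) (delta Ω y) / ‖x - y‖ ^ ((N : ℝ) + p * s)‖ ≤
        sphereArea N * (((1 - κ) * delta Ω x) ^ (-s) / s) := by
  have hd := delta_pos ho hne hx
  have hd' : 0 < sdist Ω x := by rwa [sdist_eq_delta hx]
  simp_rw [profile_delta_div_eq hx]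
  rw [← sdist_eq_delta hx]
  exact (isProfile_profile hs0 hs1 hp hd'.le).integrable_sdist_mul hN hs0 hp hd' rfl
    (mul_pos (by linarith) hd') (profile_eq_zero_of_abs_max_sub_lt hκ0 hκ1)

/-- After straightening, the main term lives on a half-space and reduces, layer by layer, to the
one-dimensional integral. -/
lemma truncOp_eq (hN : 0 < N) (hs0 : 0 < s) (hs1 : s < 1) (hp : 1 < p)
    (hκ0 : 0 < κ) (hκ1 : κ < 1) (ho : IsOpen Ω) (hne : Ωᶜ.Nonempty) (hx : x ∈ Ω)
    {n : E N} {h : E N → E N} {h' : E N → E N →L[ℝ] E N} (hst : Straightens Ω R x n h h') :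
    truncOp s p κ Ω x =
      comparisonError Ω R (N + p * s) (delta Ω x) x n h h'
        (fun t => profile s p κ (delta Ω x) (max t 0)) +
      layerConst (N - 1) (N + p * s) * (delta Ω x ^ (-s) * (profileDefect s p κ / (p * s))) := by
  have hd := delta_pos ho hne hx
  have hG : IsProfile s p (delta Ω x) fun t => profile s p κ (delta Ω x) (max t 0) :=
    isProfile_profile hs0 hs1 hp hd.le
  have hη : 0 < (1 - κ) * delta Ω x := mul_pos (by linarith) hd
  have hz := fun t => profile_eq_zero_of_abs_max_sub_lt (s := s) (p := p) (d := delta Ω x) hκ0 hκ1 t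
  rw [truncOp]
  simp_rw [profile_delta_div_eq hx]
  rw [sdist_eq_delta hx, hst.integral_eq hN hs0 hp hd (sdist_eq_delta hx) hG hη hz]
  congr 1
  have hps : 0 < p * s := by positivity
  have hi := hG.integrable_inner_mul hN hs0 hp hd (x := x) hst.norm_normal hη hz
  obtain ⟨m, rfl⟩ : ∃ m, N = m + 1 := ⟨N - 1, by omega⟩
  have hi' := hi.comp_add_right x
  simp only [add_sub_cancel_right] at hi'
  have hexp : (m : ℝ) - ((m + 1 : ℕ) + p * s) = -1 - p * s := by
    push_cast
    ring
  obtain ⟨j1, j2⟩ := integral_profile hs0 hp hκ0 hκ1 hd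
  rw [integral_sub_right_eq_self (fun z : E (m + 1) =>
    profile s p κ (delta Ω x) (max (delta Ω x + inner ℝ n z) 0) * ‖z‖ ^ (-((m + 1 : ℕ) + p * s))) x,
    integral_inner_mul_norm_rpow (m := m) (by push_cast; linarith) hst.norm_normal
      (g := fun t => profile s p κ (delta Ω x) (max (delta Ω x + t) 0))
      (hG.measurable.comp (measurable_const_add _)) hi' (by rw [hexp]; exact j1), hexp, j2]
  simp

/-- In the limit the half-space term disappears and only the bounded comparison error survives. For
finite `k` that term is at most a multiple of `δ ^ (-s)`, a majorant needed only for domination. -/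
lemma exists_tendsto_truncOp (hN : 0 < N) (hs0 : 0 < s) (hs1 : s < 1) (hp : 1 < p)
    {κ : ℕ → ℝ} (hκ0 : ∀ k, 0 < κ k) (hκ1 : ∀ k, κ k < 1)
    (hκ : Filter.Tendsto κ Filter.atTop (nhds 1))
    (ho : IsOpen Ω) (hne : Ωᶜ.Nonempty) (hR : 0 < R) (hT : TwoBall R Ω) (hx : x ∈ Ω)
    (hxR : delta Ω x < R / 24) :
    (∃ L, |L| ≤ errorConst N s p R ∧
      Filter.Tendsto (fun k => truncOp s p (κ k) Ω x) Filter.atTop (nhds L)) ∧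
    ∀ k, |truncOp s p (κ k) Ω x| ≤
      errorConst N s p R + layerConst (N - 1) (N + p * s) / (p * s) * delta Ω x ^ (-s) := by
  have hd := delta_pos ho hne hx
  have hps : 0 < p * s := by positivity
  obtain ⟨n, h, h', hst⟩ := hT.exists_straightens hR ⟨x, hx⟩ hne (x := x)
    (by rwa [sdist_eq_delta hx, abs_of_pos hd])
  have heq := fun k => truncOp_eq hN hs0 hs1 hp (hκ0 k) (hκ1 k) ho hne hx hst
  have hdx := sdist_eq_delta hx
  refine ⟨⟨comparisonError Ω R (N + p * s) (delta Ω x) x n h h'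
      fun t => spow (delta Ω x ^ s - max t 0 ^ s) (p - 1),
      hst.abs_comparisonError_le hN hs0 hs1 hp hR hd hdx (isProfile_spow hs0 hs1 hp hd.le), ?_⟩,
    fun k => ?_⟩
  · have h1 := hst.tendsto_comparisonError hN hs0 hs1 hp hR hd hdx
      (G := fun k t => profile s p (κ k) (delta Ω x) (max t 0))
      (G' := fun t => spow (delta Ω x ^ s - max t 0 ^ s) (p - 1))
      (fun k => isProfile_profile hs0 hs1 hp hd.le) (fun t => tendsto_profile _ _ hκ)
    have h2 := ((((tendsto_profileDefect hs0 hs1 hp hκ0 hκ1 hκ).div_const (p * s)).const_mul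
      (delta Ω x ^ (-s))).const_mul (layerConst (N - 1) (N + p * s)))
    rw [zero_div, mul_zero, mul_zero] at h2
    have h3 := h1.add h2
    rw [add_zero] at h3
    exact h3.congr fun k => (heq k).symm
  · rw [heq k]
    refine (abs_add_le _ _).trans (add_le_add
      (hst.abs_comparisonError_le hN hs0 hs1 hp hR hd hdx (isProfile_profile hs0 hs1 hp hd.le)) ?_)
    have h1 := profileDefect_nonneg (p := p) hs0 (hκ0 k) (hκ1 k)
    have h2 := profileDefect_le_one hs0 hs1 hp (hκ0 k) (hκ1 k)
    have h3 := layerConst_nonneg (N - 1) (N + p * s)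
    rw [abs_of_nonneg (by positivity)]
    calc _ ≤ layerConst (N - 1) (N + p * s) * (delta Ω x ^ (-s) * (1 / (p * s))) := by gcongr
      _ = _ := by ring

lemma measurable_profile_delta (Ω : Set (E N)) :
    Measurable fun z : E N × E N =>
      profile s p κ (delta Ω z.1) (delta Ω z.2) / ‖z.1 - z.2‖ ^ ((N : ℝ) + p * s) := by
  have h1 := (continuous_delta Ω).measurable
  have h2 : Measurable fun z : E N × E N => profile s p κ (delta Ω z.1) (delta Ω z.2) :=
    measurable_profile.comp (by fun_prop : Measurable fun z : E N × E N => (delta Ω z.1, delta Ω z.2))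
  fun_prop

lemma stronglyMeasurable_truncOp (Ω : Set (E N)) : StronglyMeasurable (truncOp s p κ Ω) :=
  (measurable_profile_delta Ω).stronglyMeasurable.integral_prod_right

end Truncation

/-! ### Integrability of small negative powers of the distance -/

section BoundaryIntegrability

variable {N : ℕ} {Ω : Set (E N)} {R s p : ℝ}

lemma lintegral_abs_inner_rpow_ball_lt_top (hN : 0 < N) {a r : ℝ} (ha0 : 0 < a) (ha1 : a < 1)
    (hr : 0 < r) {n : E N} (hn : ‖n‖ = 1) (x : E N) :
    ∫⁻ z in Metric.ball x r, ENNReal.ofReal (|inner ℝ n (z - x)| ^ (-a)) < ∞ := by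
  obtain ⟨m, rfl⟩ : ∃ m, N = m + 1 := ⟨N - 1, by omega⟩
  -- An artificial weight `|z| ^ (-q)`, at least `r ^ (-q)` off the centre, allows the layer
  -- formula. This `q` exceeds `m` and leaves `|t| ^ (-(1 + a) / 2)`, still integrable at `0`.
  set q : ℝ := m + (1 - a) / 2 with hq
  have hq0 : 0 < q := by
    have : (0 : ℝ) ≤ m := m.cast_nonneg
    linarith
  set g : ℝ → ℝ≥0∞ := (Set.Ioo (-r) r).indicator fun t => ENNReal.ofReal (|t| ^ (-a)) with hg
  have hgm : Measurable g := Measurable.indicator (by fun_prop) measurableSet_Ioo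
  have h1 := lintegral_inner_mul_norm_rpow (m := m) (q := q) (by linarith) hn hgm
  have h2 : ∫⁻ t, g t * ENNReal.ofReal (|t| ^ (m - q)) < ∞ := by
    have e : (fun t => g t * ENNReal.ofReal (|t| ^ (m - q))) =
        (Set.Ioo (-r) r).indicator
          fun t => ENNReal.ofReal (|t| ^ (-a) * |t| ^ (m - q)) := by
      ext t
      by_cases ht : t ∈ Set.Ioo (-r) r
      · rw [hg, Set.indicator_of_mem ht, Set.indicator_of_mem ht,
          ENNReal.ofReal_mul (by positivity)]
      · rw [hg, Set.indicator_of_notMem ht, Set.indicator_of_notMem ht, zero_mul]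
    rw [e, lintegral_indicator measurableSet_Ioo]
    have hi : IntegrableOn (fun t : ℝ => |t| ^ (-(1 + a) / 2)) (Set.Ioo (-r) r) := by
      have hd : Module.finrank ℝ ℝ = 1 := Module.finrank_self ℝ
      have := integrableOn_ball_of_norm_le_rpow (E := ℝ) (μ := volume) (by rw [hd])
        (f := fun t : ℝ => |t| ^ (-(1 + a) / 2)) (C := 1) (α := (1 + a) / 2) (r := r)
        (by rw [hd]; push_cast; linarith)
        (Filter.Eventually.of_forall fun t => by
          rw [Real.norm_of_nonneg (by positivity), one_mul, Real.norm_eq_abs, neg_div])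
        (Measurable.aestronglyMeasurable (by fun_prop))
      rwa [Real.ball_eq_Ioo, zero_sub, zero_add] at this
    refine lt_of_le_of_lt (lintegral_mono fun t => ?_) hi.lintegral_lt_top
    refine ENNReal.ofReal_le_ofReal ?_
    rcases (abs_nonneg t).eq_or_lt with h0 | h0
    · rw [← h0, Real.zero_rpow (by linarith), zero_mul]
      exact Real.rpow_nonneg le_rfl _
    · rw [← Real.rpow_add h0]
      refine le_of_eq ?_
      congr 1
      rw [hq]
      ring
  have h3 : ∫⁻ z : E (m + 1), g (inner ℝ n z) * ENNReal.ofReal (‖z‖ ^ (-q)) < ∞ := by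
    rw [h1]
    exact ENNReal.mul_lt_top ENNReal.ofReal_lt_top h2
  rw [← lintegral_sub_right_eq_self _ x] at h3
  rw [← lintegral_indicator Metric.isOpen_ball.measurableSet]
  have h4 : ENNReal.ofReal (r ^ q) *
      ∫⁻ z : E (m + 1), g (inner ℝ n (z - x)) * ENNReal.ofReal (‖z - x‖ ^ (-q)) < ∞ :=
    ENNReal.mul_lt_top ENNReal.ofReal_lt_top h3
  refine lt_of_le_of_lt ?_ h4
  rw [← lintegral_const_mul _ (by fun_prop)]
  refine lintegral_mono fun z => ?_
  by_cases hz : z ∈ Metric.ball x r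
  · rw [Set.indicator_of_mem hz]
    rw [Metric.mem_ball, dist_eq_norm] at hz
    have hin : |inner ℝ n (z - x)| ≤ ‖z - x‖ := by
      have := abs_real_inner_le_norm n (z - x)
      rwa [hn, one_mul] at this
    have hmem : inner ℝ n (z - x) ∈ Set.Ioo (-r) r := abs_lt.1 (hin.trans_lt hz)
    simp only [hg]
    rw [Set.indicator_of_mem hmem]
    rcases (norm_nonneg (z - x)).eq_or_lt with h0 | h0
    · have : inner ℝ n (z - x) = 0 := by
        rw [← h0] at hin
        exact abs_nonpos_iff.1 hin
      rw [this, abs_zero, Real.zero_rpow (by linarith)]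
      simp
    · rw [mul_left_comm, ← ENNReal.ofReal_mul (by positivity)]
      refine le_mul_of_one_le_right zero_le ?_
      rw [ENNReal.one_le_ofReal, Real.rpow_neg h0.le, ← div_eq_mul_inv, one_le_div (by positivity)]
      gcongr
  · rw [Set.indicator_of_notMem hz]
    exact zero_le

/-- Straightening at a boundary point turns the signed distance into a linear function; the Jacobian
is at least `3 / 4`, so the change of variables loses at most a factor `2`. -/
lemma Straightens.lintegral_abs_sdist_rpow_lt_top {x n : E N} {h : E N → E N}
    {h' : E N → E N →L[ℝ] E N} (hst : Straightens Ω R x n h h') (hN : 0 < N) (hR : 0 < R)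
    (hx : sdist Ω x = 0) {a : ℝ} (ha0 : 0 < a) (ha1 : a < 1) :
    ∫⁻ y in Metric.ball x (R / 24), ENNReal.ofReal (|sdist Ω y| ^ (-a)) < ∞ := by
  set B := Metric.ball x (R / 24) with hBdef
  have hB : MeasurableSet B := Metric.isOpen_ball.measurableSet
  have himg : h '' B ⊆ Metric.ball x (R / 12) := by
    rintro _ ⟨y, hy, rfl⟩
    have h1 := hst.norm_sub_le y
    rw [hBdef, Metric.mem_ball, dist_eq_norm] at hy
    have h2 : ‖y - x‖ ^ 2 / R ≤ R / 24 := by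
      rw [div_le_iff₀ hR]
      nlinarith [norm_nonneg (y - x)]
    rw [Metric.mem_ball, dist_eq_norm]
    have := norm_sub_le_norm_sub_add_norm_sub (h y) y x
    linarith
  have hfin := (lintegral_mono_set himg).trans_lt
    (lintegral_abs_inner_rpow_ball_lt_top hN ha0 ha1 (by positivity : 0 < R / 12)
      hst.norm_normal x)
  rw [lintegral_image_eq_lintegral_abs_det_fderiv_mul volume hB
    (fun y hy => (hst.hasFDerivAt y hy).hasFDerivWithinAt) hst.injOn] at hfin
  have hle : ∫⁻ y in B, ENNReal.ofReal (|sdist Ω y| ^ (-a)) ≤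
      ENNReal.ofReal 2 * ∫⁻ y in B, ENNReal.ofReal |(h' y).det| *
        ENNReal.ofReal (|inner ℝ n (h y - x)| ^ (-a)) := by
    rw [← lintegral_const_mul' _ _ (by simp)]
    refine setLIntegral_mono' hB fun y hy => ?_
    have hdet := (abs_le.1 (hst.det_sub_le y hy)).1
    rw [hBdef, Metric.mem_ball, dist_eq_norm] at hy
    have h6 : 6 / R * ‖y - x‖ ≤ 1 / 4 := by
      calc 6 / R * ‖y - x‖ ≤ 6 / R * (R / 24) := by gcongr
        _ = 1 / 4 := by field_simp; norm_num
    have h1 : 1 ≤ 2 * |(h' y).det| := by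
      have := le_abs_self (h' y).det
      linarith
    rw [hst.sdist_eq y, hx, zero_add, ← mul_assoc]
    refine le_mul_of_one_le_left zero_le ?_
    rw [← ENNReal.ofReal_mul two_pos.le, ENNReal.one_le_ofReal]
    exact h1
  exact hle.trans_lt (ENNReal.mul_lt_top (by simp) hfin)

/-- Small negative powers of the distance to the boundary are integrable. -/
lemma TwoBall.lintegral_delta_rpow_lt_top (hT : TwoBall R Ω) (hN : 0 < N) (hR : 0 < R)
    (ho : IsOpen Ω) (hb : Bornology.IsBounded Ω) (hne' : Ω.Nonempty) (hne : Ωᶜ.Nonempty) {a : ℝ}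
    (ha0 : 0 < a) (ha1 : a < 1) :
    ∫⁻ y in Ω, ENNReal.ofReal (delta Ω y ^ (-a)) < ∞ := by
  suffices H : ∫⁻ y in closure Ω ∩ Ω, ENNReal.ofReal (delta Ω y ^ (-a)) < ∞ by
    rwa [Set.inter_eq_right.2 subset_closure] at H
  -- Around interior points the integrand is bounded; around boundary points the straightened
  -- estimate applies.
  refine hb.isCompact_closure.induction_on
    (p := fun t => ∫⁻ y in t ∩ Ω, ENNReal.ofReal (delta Ω y ^ (-a)) < ∞) ?_ ?_ ?_ ?_
  · simp
  · intro t t' htt' h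
    exact (lintegral_mono_set (Set.inter_subset_inter_left _ htt')).trans_lt h
  · intro t t' h h'
    rw [Set.union_inter_distrib_right]
    exact (lintegral_union_le _ _ _).trans_lt (ENNReal.add_lt_top.2 ⟨h, h'⟩)
  · intro x hx
    by_cases hxΩ : x ∈ Ω
    · have hd := delta_pos ho hne hxΩ
      refine ⟨Metric.ball x (delta Ω x / 2), mem_nhdsWithin_of_mem_nhds
        (Metric.ball_mem_nhds _ (by positivity)), ?_⟩
      refine (lintegral_mono_set Set.inter_subset_left).trans_lt ?_
      refine (setLIntegral_mono' Metric.isOpen_ball.measurableSet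
        (g := fun _ => ENNReal.ofReal ((delta Ω x / 2) ^ (-a))) fun y hy => ?_).trans_lt ?_
      · refine ENNReal.ofReal_le_ofReal
          (Real.rpow_le_rpow_of_nonpos (by positivity) ?_ (by linarith))
        rw [Metric.mem_ball, dist_eq_norm] at hy
        have := (abs_le.1 (abs_delta_sub_le Ω y x)).1
        linarith
      · rw [setLIntegral_const]
        exact ENNReal.mul_lt_top ENNReal.ofReal_lt_top measure_ball_lt_top
    · have hx0 : sdist Ω x = 0 := by
        rw [sdist_of_notMem hxΩ, neg_eq_zero, ← Metric.infDist_closure]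
        exact Metric.infDist_zero_of_mem hx
      obtain ⟨n, h, h', hst⟩ := hT.exists_straightens hR hne' hne (x := x)
        (by rw [hx0, abs_zero]; positivity)
      refine ⟨Metric.ball x (R / 24), mem_nhdsWithin_of_mem_nhds
        (Metric.ball_mem_nhds _ (by positivity)), ?_⟩
      refine lt_of_le_of_lt ?_ (hst.lintegral_abs_sdist_rpow_lt_top hN hR hx0 ha0 ha1)
      refine (setLIntegral_mono' (Metric.isOpen_ball.measurableSet.inter ho.measurableSet)
        fun y hy => ?_).trans (lintegral_mono_set Set.inter_subset_left)
      rw [sdist_eq_delta hy.2, abs_of_nonneg (delta_nonneg _ _)]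

end BoundaryIntegrability

/-! ### Hardy's inequality near the boundary -/

section Hardy

variable {N : ℕ} {Ω : Set (E N)} {R s p : ℝ}

lemma aemeasurable_gagliardo_density {u : E N → ℝ} (hu : AEStronglyMeasurable u) :
    AEMeasurable (fun z : E N × E N =>
      ENNReal.ofReal (|u z.1 - u z.2| ^ p / ‖z.1 - z.2‖ ^ ((N : ℝ) + p * s))) := by
  have h1 : AEMeasurable (fun z : E N × E N => u z.1) := hu.aemeasurable.comp_fst
  have h2 : AEMeasurable (fun z : E N × E N => u z.2) := hu.aemeasurable.comp_snd
  fun_prop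

lemma gagliardo_univ_eq {u : E N → ℝ} (hu : AEStronglyMeasurable u) :
    gagliardo s p Set.univ u =
      ∫⁻ x, ∫⁻ y, ENNReal.ofReal (|u x - u y| ^ p / ‖x - y‖ ^ ((N : ℝ) + p * s)) := by
  rw [gagliardo, Set.univ_prod_univ, Measure.restrict_univ, Measure.volume_eq_prod,
    lintegral_prod _ (aemeasurable_gagliardo_density hu)]

/-- Hardy's inequality for functions vanishing outside a strip along the boundary. -/
lemma TwoBall.hardy (hT : TwoBall R Ω) (hN : 0 < N) (hs0 : 0 < s) (hp : 1 < p) (hR : 0 < R)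
    (ho : IsOpen Ω) (hne : Ωᶜ.Nonempty) {U : Set (E N)} (hUm : MeasurableSet U) (hU : U ⊆ Ω)
    (hUR : ∀ x ∈ U, delta Ω x ≤ R) {φ : E N → ℝ} (hφ : MemW0 s p U φ) :
    ∫⁻ x in U, ENNReal.ofReal ((delta Ω x ^ (-s) * |φ x|) ^ p) < ∞ := by
  have hps : 0 < p * s := by positivity
  have hq : 0 < (N : ℝ) + p * s := by positivity
  have hφm : AEStronglyMeasurable φ := by
    have := hφ.1.1.1
    rwa [Measure.restrict_univ] at this
  have hfin := hφ.1.2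
  rw [gagliardo_univ_eq hφm] at hfin
  set ω : ℝ≥0∞ := volume (Metric.ball (0 : E N) 1) with hω
  have hω0 : ω ≠ 0 := (Metric.measure_ball_pos volume _ one_pos).ne'
  have hωt : ω ≠ ∞ := measure_ball_lt_top.ne
  set c : ℝ≥0∞ := ENNReal.ofReal (3 ^ (-((N : ℝ) + p * s))) * ω with hc
  have hc0 : c ≠ 0 := mul_ne_zero (by simp; positivity) hω0
  have hct : c ≠ ∞ := ENNReal.mul_ne_top ENNReal.ofReal_ne_top hωt
  have key : ∀ x ∈ U, c * ENNReal.ofReal ((delta Ω x ^ (-s) * |φ x|) ^ p) ≤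
      ∫⁻ y, ENNReal.ofReal (|φ x - φ y| ^ p / ‖x - y‖ ^ ((N : ℝ) + p * s)) := by
    intro x hx
    have hd := delta_pos ho hne (hU hx)
    obtain ⟨n, hn, -, h2⟩ := hT.exists_normal_of_mem hR hne (hU hx)
    change Metric.ball (x - (R + delta Ω x) • n) R ⊆ Ωᶜ at h2
    set d := delta Ω x with hdd
    -- A ball of radius `d` outside `Ω` and within `3 d` of `x`, available because `d ≤ R`. There
    -- `φ` vanishes, and integrating the energy over it alone gives `|φ(x)|^p d^N d^{-N-ps}` up to a
    -- constant.
    have hball : Metric.ball (x - (2 * d) • n) d ⊆ Ωᶜ := by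
      refine (Metric.ball_subset_ball' ?_).trans h2
      rw [dist_sub_left, dist_eq_norm, ← sub_smul, norm_smul, hn, Real.norm_eq_abs,
        abs_of_nonpos (by linarith [hUR x hx])]
      linarith
    have hdist : ∀ y ∈ Metric.ball (x - (2 * d) • n) d, ‖x - y‖ ≤ 3 * d := by
      intro y hy
      have h3 : x - y = (x - (2 * d) • n - y) + (2 * d) • n := by abel
      rw [Metric.mem_ball, dist_comm, dist_eq_norm] at hy
      rw [h3]
      refine (norm_add_le _ _).trans ?_
      rw [norm_smul, hn, Real.norm_of_nonneg (by positivity)]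
      linarith
    calc c * ENNReal.ofReal ((d ^ (-s) * |φ x|) ^ p)
        = ∫⁻ y in Metric.ball (x - (2 * d) • n) d,
            ENNReal.ofReal (|φ x| ^ p / (3 * d) ^ ((N : ℝ) + p * s)) := by
          rw [setLIntegral_const, Measure.addHaar_ball_of_pos _ _ hd, ← hω, hc]
          have hfr : Module.finrank ℝ (E N) = N := by simp
          rw [hfr, mul_right_comm, ← mul_assoc, ← ENNReal.ofReal_mul (by positivity),
            ← ENNReal.ofReal_mul (by positivity)]
          congr 2
          rw [Real.mul_rpow (by positivity) (abs_nonneg _), ← Real.rpow_mul hd.le,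
            Real.mul_rpow (by norm_num) hd.le, Real.rpow_neg (by norm_num),
            Real.rpow_add hd, Real.rpow_natCast, show -s * p = -(p * s) by ring,
            Real.rpow_neg hd.le]
          field_simp
      _ ≤ ∫⁻ y in Metric.ball (x - (2 * d) • n) d,
            ENNReal.ofReal (|φ x - φ y| ^ p / ‖x - y‖ ^ ((N : ℝ) + p * s)) := by
          refine setLIntegral_mono_ae' Metric.isOpen_ball.measurableSet ?_
          filter_upwards [hφ.2] with y hy hyb
          have hyΩ : y ∉ Ω := hball hyb
          rw [hy fun h => hyΩ (hU h), sub_zero]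
          have hxy : 0 < ‖x - y‖ := by
            rw [norm_pos_iff, sub_ne_zero]
            rintro rfl
            exact hyΩ (hU hx)
          have := hdist y hyb
          gcongr
      _ ≤ _ := setLIntegral_le_lintegral _ _
  have h3 : c * ∫⁻ x in U, ENNReal.ofReal ((delta Ω x ^ (-s) * |φ x|) ^ p) < ∞ := by
    rw [← lintegral_const_mul' _ _ hct]
    exact ((setLIntegral_mono' hUm key).trans (setLIntegral_le_lintegral _ _)).trans_lt hfin
  exact ENNReal.lt_top_of_mul_ne_top_right h3.ne hc0

/-- Hardy bounds the `p`-th power; on a set of finite measure `t ≤ 1 + t ^ p` gives integrability.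
-/
lemma TwoBall.integrableOn_delta_rpow_mul (hT : TwoBall R Ω) (hN : 0 < N) (hs0 : 0 < s)
    (hp : 1 < p) (hR : 0 < R) (ho : IsOpen Ω) (hb : Bornology.IsBounded Ω) (hne : Ωᶜ.Nonempty)
    {U : Set (E N)} (hUm : MeasurableSet U) (hU : U ⊆ Ω) (hUR : ∀ x ∈ U, delta Ω x ≤ R)
    {φ : E N → ℝ} (hφ : MemW0 s p U φ) :
    IntegrableOn (fun x => delta Ω x ^ (-s) * |φ x|) U := by
  have hφm : AEStronglyMeasurable φ := by
    have := hφ.1.1.1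
    rwa [Measure.restrict_univ] at this
  have h1 := (continuous_delta Ω).measurable
  have hm : AEMeasurable (fun x => delta Ω x ^ (-s) * |φ x|) := by
    have := hφm.aemeasurable
    fun_prop
  refine ⟨hm.aestronglyMeasurable.restrict, ?_⟩
  have hUf : volume U < ∞ := (hb.subset hU).measure_lt_top
  have hnn : ∀ x, 0 ≤ delta Ω x ^ (-s) * |φ x| := fun x =>
    mul_nonneg (Real.rpow_nonneg (delta_nonneg _ _) _) (abs_nonneg _)
  rw [hasFiniteIntegral_iff_ofReal (Filter.Eventually.of_forall hnn)]
  have hH := hT.hardy hN hs0 hp hR ho hne hUm hU hUR hφ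
  have h2 : ∫⁻ x in U, (1 + ENNReal.ofReal ((delta Ω x ^ (-s) * |φ x|) ^ p)) < ∞ := by
    rw [lintegral_add_left measurable_const, setLIntegral_const, one_mul]
    exact ENNReal.add_lt_top.2 ⟨hUf, hH⟩
  refine lt_of_le_of_lt (lintegral_mono fun x => ?_) h2
  have hx := hnn x
  set t := delta Ω x ^ (-s) * |φ x|
  rw [← ENNReal.ofReal_one, ← ENNReal.ofReal_add zero_le_one (Real.rpow_nonneg hx _)]
  refine ENNReal.ofReal_le_ofReal ?_
  rcases le_total t 1 with ht | ht
  · have := Real.rpow_nonneg hx p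
    linarith
  · have := Real.self_le_rpow_of_one_le ht hp.le
    linarith

end Hardy

/-! ### Finite energy of `δ ^ s` -/

section Energy

variable {N : ℕ} {Ω : Set (E N)} {R s p : ℝ}

lemma exists_delta_le (hb : Bornology.IsBounded Ω) (hne : Ωᶜ.Nonempty) :
    ∃ Δ : ℝ, 0 < Δ ∧ ∀ x, delta Ω x ≤ Δ := by
  obtain ⟨y, hy⟩ := hne
  obtain ⟨r, hr⟩ := hb.subset_ball y
  refine ⟨max r 1, by positivity, fun x => ?_⟩
  by_cases hx : x ∈ Ω
  · exact (Metric.infDist_le_dist_of_mem hy).trans ((hr hx).le.trans (le_max_left _ _))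
  · rw [delta_eq_zero hx]
    positivity

/-- The contribution of nearby points to the energy density of `δ ^ s`. -/
lemma lintegral_energy_near (hN : 0 < N) (hs0 : 0 < s) (hs1 : s < 1) (hp : 1 < p) {x : E N}
    (hd : 0 < delta Ω x) :
    ∫⁻ y in Metric.ball x (delta Ω x / 2),
      ENNReal.ofReal (|delta Ω x ^ s - delta Ω y ^ s| ^ p / ‖x - y‖ ^ ((N : ℝ) + p * s)) ≤
      ENNReal.ofReal (sphereArea N * (1 / (p * (1 - s)))) := by
  set d := delta Ω x with hdd
  have he : 0 < p * (1 - s) := mul_pos (by linarith) (by linarith)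
  obtain ⟨i1, v1⟩ := integrableOn_norm_sub_rpow_ball hN he (half_pos hd) x
  have hle : ∀ y ∈ Metric.ball x (d / 2),
      |d ^ s - delta Ω y ^ s| ^ p / ‖x - y‖ ^ ((N : ℝ) + p * s) ≤
        (d / 2) ^ (-(p * (1 - s))) * ‖y - x‖ ^ (p * (1 - s) - N) := by
    intro y hy
    rw [Metric.mem_ball, dist_eq_norm] at hy
    have hy2 : d / 2 ≤ delta Ω y := by
      have := (abs_le.1 (abs_delta_sub_le Ω y x)).1
      linarith
    -- On this ball `δ ≥ d / 2`, away from the singularity of `t ^ s`, which is then Lipschitz with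
    -- constant `(d / 2) ^ (s - 1)`.
    have hlip := Convex.norm_image_sub_le_of_norm_hasDerivWithin_le (f := fun t : ℝ => t ^ s)
      (f' := fun t => s * t ^ (s - 1)) (s := Set.Ici (d / 2)) (x := delta Ω y) (y := d)
      (C := (d / 2) ^ (s - 1)) (fun t ht => ?_) (fun t ht => ?_) (convex_Ici _) hy2
      (show d / 2 ≤ d by linarith)
    · rw [Real.norm_eq_abs, Real.norm_eq_abs] at hlip
      have h1 : |d ^ s - delta Ω y ^ s| ≤ (d / 2) ^ (s - 1) * ‖y - x‖ := by
        refine hlip.trans ?_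
        rw [norm_sub_rev]
        gcongr
        exact abs_delta_sub_le Ω x y
      rw [norm_sub_rev x y]
      rcases (norm_nonneg (y - x)).eq_or_lt with h0 | h0
      · have hyx : y = x := by rw [← sub_eq_zero, ← norm_eq_zero, h0]
        rw [hyx, ← hdd, sub_self, abs_zero, Real.zero_rpow (by linarith), zero_div]
        positivity
      · calc |d ^ s - delta Ω y ^ s| ^ p / ‖y - x‖ ^ ((N : ℝ) + p * s)
            ≤ ((d / 2) ^ (s - 1) * ‖y - x‖) ^ p / ‖y - x‖ ^ ((N : ℝ) + p * s) := by gcongr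
          _ = _ := by
            rw [Real.mul_rpow (by positivity) h0.le, ← Real.rpow_mul (by positivity), mul_div_assoc,
              ← Real.rpow_sub h0]
            congr 2 <;> ring
    · have ht' : 0 < t := lt_of_lt_of_le (by linarith) ht
      exact (Real.hasDerivAt_rpow_const (Or.inl ht'.ne')).hasDerivWithinAt
    · have ht' : d / 2 ≤ t := ht
      have ht0 : 0 < t := lt_of_lt_of_le (by linarith) ht
      have h1 : t ^ (s - 1) ≤ (d / 2) ^ (s - 1) :=
        Real.rpow_le_rpow_of_nonpos (by linarith) ht' (by linarith)
      rw [norm_mul, Real.norm_of_nonneg hs0.le, Real.norm_of_nonneg (by positivity)]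
      calc s * t ^ (s - 1) ≤ 1 * (d / 2) ^ (s - 1) := by gcongr
        _ = _ := one_mul _
  refine (setLIntegral_mono' Metric.isOpen_ball.measurableSet
    fun y hy => ENNReal.ofReal_le_ofReal (hle y hy)).trans ?_
  rw [← ofReal_integral_eq_lintegral_ofReal (i1.const_mul _)
    (Filter.Eventually.of_forall fun y => by positivity), integral_const_mul, v1]
  refine ENNReal.ofReal_le_ofReal (le_of_eq ?_)
  rw [Real.rpow_neg (by positivity)]
  have : 0 < (d / 2) ^ (p * (1 - s)) := by positivity
  field_simp

/-- The contribution of distant points to the energy density of `δ ^ s`. -/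
lemma lintegral_energy_far (hN : 0 < N) (hs0 : 0 < s) (hs1 : s < 1) (hp : 1 < p) {x : E N}
    (hd : 0 < delta Ω x) {Δ : ℝ} (hΔ : ∀ x, delta Ω x ≤ Δ) {a : ℝ} (ha0 : 0 < a)
    (ha : a ≤ p * s) :
    ∫⁻ y in (Metric.ball x (delta Ω x / 2))ᶜ,
      ENNReal.ofReal (|delta Ω x ^ s - delta Ω y ^ s| ^ p / ‖x - y‖ ^ ((N : ℝ) + p * s)) ≤
      ENNReal.ofReal (Δ ^ a * sphereArea N * (2 ^ a / a)) *
        ENNReal.ofReal (delta Ω x ^ (-a)) := by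
  set d := delta Ω x with hdd
  have hΔ0 : 0 < Δ := hd.trans_le (hΔ x)
  obtain ⟨i1, v1⟩ := integrableOn_norm_sub_rpow_compl_ball hN ha0 (half_pos hd) x
  have hle : ∀ y ∈ (Metric.ball x (d / 2))ᶜ,
      |d ^ s - delta Ω y ^ s| ^ p / ‖x - y‖ ^ ((N : ℝ) + p * s) ≤
        Δ ^ a * ‖y - x‖ ^ (-a - N) := by
    intro y hy
    rw [Set.mem_compl_iff, Metric.mem_ball, dist_eq_norm, not_lt] at hy
    have h0 : 0 < ‖y - x‖ := lt_of_lt_of_le (half_pos hd) hy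
    have h1 : |d - delta Ω y| ≤ Δ := by
      rw [abs_le]
      constructor <;> linarith [hΔ x, hΔ y, delta_nonneg Ω x, delta_nonneg Ω y]
    have h2 : |d - delta Ω y| ≤ ‖y - x‖ := by
      rw [norm_sub_rev]
      exact abs_delta_sub_le Ω x y
    -- Only the part `p s - a` of the exponent is spent on the distance, the rest on the bound `Δ`.
    -- The final power is then `δ ^ (-a)` instead of `δ ^ (-p s)`, whose exponent could be too large
    -- to integrate.
    have h3 : |d ^ s - delta Ω y ^ s| ^ p ≤ Δ ^ a * ‖y - x‖ ^ (p * s - a) := by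
      calc |d ^ s - delta Ω y ^ s| ^ p ≤ (|d - delta Ω y| ^ s) ^ p := by
            have := abs_rpow_sub_rpow_le hs0 hs1 hd.le (delta_nonneg Ω y)
            gcongr
        _ = |d - delta Ω y| ^ a * |d - delta Ω y| ^ (p * s - a) := by
            rw [← Real.rpow_mul (abs_nonneg _), ← Real.rpow_add_of_nonneg (abs_nonneg _) ha0.le
              (by linarith)]
            congr 1
            ring
        _ ≤ Δ ^ a * ‖y - x‖ ^ (p * s - a) := by
            have : 0 ≤ p * s - a := by linarith
            gcongr
    rw [norm_sub_rev x y]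
    calc _ ≤ Δ ^ a * ‖y - x‖ ^ (p * s - a) / ‖y - x‖ ^ ((N : ℝ) + p * s) := by gcongr
      _ = _ := by
        rw [mul_div_assoc, ← Real.rpow_sub h0]
        congr 2
        ring
  refine (setLIntegral_mono' Metric.isOpen_ball.measurableSet.compl
    fun y hy => ENNReal.ofReal_le_ofReal (hle y hy)).trans ?_
  rw [← ofReal_integral_eq_lintegral_ofReal (i1.const_mul _)
    (Filter.Eventually.of_forall fun y => by positivity), integral_const_mul, v1,
    ← ENNReal.ofReal_mul' (by positivity)]
  refine ENNReal.ofReal_le_ofReal (le_of_eq ?_)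
  rw [Real.div_rpow hd.le two_pos.le, Real.rpow_neg two_pos.le, div_inv_eq_mul]
  ring

lemma TwoBall.gagliardo_delta_rpow_lt_top (hT : TwoBall R Ω) (hN : 0 < N) (hs0 : 0 < s)
    (hs1 : s < 1) (hp : 1 < p) (hR : 0 < R) (ho : IsOpen Ω) (hb : Bornology.IsBounded Ω)
    (hne' : Ω.Nonempty) (hne : Ωᶜ.Nonempty) :
    gagliardo s p Set.univ (fun x => delta Ω x ^ s) < ∞ := by
  have hps : 0 < p * s := by positivity
  have hum : Measurable fun x : E N => delta Ω x ^ s := by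
    have := (continuous_delta Ω).measurable
    fun_prop
  set F : E N → E N → ℝ≥0∞ := fun x y =>
    ENNReal.ofReal (|delta Ω x ^ s - delta Ω y ^ s| ^ p / ‖x - y‖ ^ ((N : ℝ) + p * s)) with hF
  have hFm : Measurable (Function.uncurry F) := by
    have h1 := (continuous_delta Ω).measurable
    simp only [hF, Function.uncurry_def]
    fun_prop
  have hFswap : ∀ x y, F x y = F y x := by
    intro x y
    simp only [hF]
    rw [abs_sub_comm, norm_sub_rev]
  obtain ⟨Δ, hΔ0, hΔ⟩ := exists_delta_le hb hne
  -- Below `1` for integrability of `δ ^ (-a)`, and at most `p s` for the far estimate.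
  set a : ℝ := min (1 / 2) (p * s)
  have ha0 : 0 < a := by positivity
  have ha1 : a < 1 := (min_le_left _ _).trans_lt (by norm_num)
  have hinner : ∫⁻ x in Ω, ∫⁻ y, F x y < ∞ := by
    have hle : ∀ x ∈ Ω, ∫⁻ y, F x y ≤ ENNReal.ofReal (sphereArea N * (1 / (p * (1 - s)))) +
        ENNReal.ofReal (Δ ^ a * sphereArea N * (2 ^ a / a)) *
          ENNReal.ofReal (delta Ω x ^ (-a)) := by
      intro x hx
      have hd := delta_pos ho hne hx
      rw [← lintegral_add_compl _ (Metric.isOpen_ball (x := x)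
        (ε := delta Ω x / 2)).measurableSet]
      exact add_le_add (lintegral_energy_near hN hs0 hs1 hp hd)
        (lintegral_energy_far hN hs0 hs1 hp hd hΔ ha0 (min_le_right _ _))
    refine (setLIntegral_mono' ho.measurableSet hle).trans_lt ?_
    rw [lintegral_add_left measurable_const, setLIntegral_const,
      lintegral_const_mul' _ _ ENNReal.ofReal_ne_top]
    exact ENNReal.add_lt_top.2 ⟨ENNReal.mul_lt_top ENNReal.ofReal_lt_top hb.measure_lt_top,
      ENNReal.mul_lt_top ENNReal.ofReal_lt_top
        (hT.lintegral_delta_rpow_lt_top hN hR ho hb hne' hne ha0 ha1)⟩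
  rw [gagliardo_univ_eq hum.aestronglyMeasurable]
  change ∫⁻ x, ∫⁻ y, F x y < ∞
  -- Pairs with both points outside `Ω` contribute nothing, and the mixed pairs reduce by symmetry
  -- to the case `x ∈ Ω`.
  have hout : ∫⁻ x in Ωᶜ, ∫⁻ y, F x y ≤ ∫⁻ y in Ω, ∫⁻ x, F y x := by
    have h1 : ∀ x ∈ Ωᶜ, ∫⁻ y, F x y = ∫⁻ y in Ω, F x y := by
      intro x hx
      have h0 : ∫⁻ y in Ωᶜ, F x y = 0 := by
        refine (setLIntegral_congr_fun ho.measurableSet.compl fun y hy => ?_).trans lintegral_zero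
        simp only [hF]
        rw [delta_eq_zero hx, delta_eq_zero hy, sub_self, abs_zero, Real.zero_rpow (by linarith),
          zero_div, ENNReal.ofReal_zero]
      rw [← lintegral_add_compl _ ho.measurableSet, h0, add_zero]
    rw [setLIntegral_congr_fun ho.measurableSet.compl h1,
      lintegral_lintegral_swap hFm.aemeasurable]
    refine lintegral_mono fun y => (setLIntegral_le_lintegral _ _).trans (le_of_eq ?_)
    exact lintegral_congr fun x => hFswap x y
  rw [← lintegral_add_compl _ ho.measurableSet]
  exact ENNReal.add_lt_top.2 ⟨hinner, hout.trans_lt hinner⟩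

lemma TwoBall.memWtilde_delta_rpow (hT : TwoBall R Ω) (hN : 0 < N) (hs0 : 0 < s)
    (hs1 : s < 1) (hp : 1 < p) (hR : 0 < R) (ho : IsOpen Ω) (hb : Bornology.IsBounded Ω)
    (hne' : Ω.Nonempty) (hne : Ωᶜ.Nonempty) (U : Set (E N)) :
    MemWtilde s p U (fun x => delta Ω x ^ s) := by
  obtain ⟨Δ, hΔ0, hΔ⟩ := exists_delta_le hb hne
  have hum : Measurable fun x : E N => delta Ω x ^ s := by
    have := (continuous_delta Ω).measurable
    fun_prop
  have hu0 : ∀ x, 0 ≤ delta Ω x ^ s := fun x => Real.rpow_nonneg (delta_nonneg _ _) _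
  have hbd : ∀ x, delta Ω x ^ s ≤ Δ ^ s := fun x =>
    Real.rpow_le_rpow (delta_nonneg _ _) (hΔ x) hs0.le
  have hbd' : ∀ x, ‖delta Ω x ^ s‖ ≤ Δ ^ s := fun x => by
    rw [Real.norm_of_nonneg (hu0 x)]
    exact hbd x
  have huΩ : ∀ x, x ∉ Ω → delta Ω x ^ s = 0 := fun x hx => by
    rw [delta_eq_zero hx, Real.zero_rpow hs0.ne']
  refine ⟨fun K hK => ?_, ⟨Set.univ, isOpen_univ, Set.subset_univ _, ?_,
    hT.gagliardo_delta_rpow_lt_top hN hs0 hs1 hp hR ho hb hne' hne⟩, ?_⟩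
  · have : IsFiniteMeasure (volume.restrict K) := ⟨by
      rw [Measure.restrict_apply_univ]
      exact hK.measure_lt_top⟩
    exact MemLp.of_bound hum.aestronglyMeasurable _ (Filter.Eventually.of_forall hbd')
  · rw [Measure.restrict_univ]
    have : IsFiniteMeasure (volume.restrict Ω) := ⟨by
      rw [Measure.restrict_apply_univ]
      exact hb.measure_lt_top⟩
    have h1 : MemLp (fun x => delta Ω x ^ s) (ENNReal.ofReal p) (volume.restrict Ω) :=
      MemLp.of_bound hum.aestronglyMeasurable _ (Filter.Eventually.of_forall hbd')
    rw [← memLp_indicator_iff_restrict ho.measurableSet] at h1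
    refine h1.ae_eq (Filter.Eventually.of_forall fun x => ?_)
    by_cases hx : x ∈ Ω
    · rw [Set.indicator_of_mem hx]
    · rw [Set.indicator_of_notMem hx]
      exact (huΩ x hx).symm
  · have hps : 0 < p * s := by positivity
    refine lt_of_le_of_lt (lintegral_mono
      (g := Ω.indicator fun _ => ENNReal.ofReal ((Δ ^ s) ^ (p - 1))) fun x => ?_) ?_
    · by_cases hx : x ∈ Ω
      · rw [Set.indicator_of_mem hx]
        refine ENNReal.ofReal_le_ofReal ?_
        have h1 : 1 ≤ (1 + ‖x‖) ^ ((N : ℝ) + p * s) :=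
          Real.one_le_rpow (by linarith [norm_nonneg x]) (by positivity)
        have h2 : |delta Ω x ^ s| ^ (p - 1) ≤ (Δ ^ s) ^ (p - 1) := by
          have : 0 ≤ p - 1 := by linarith
          gcongr
          exact hbd' x
        exact (div_le_self (by positivity) h1).trans h2
      · beta_reduce
        rw [Set.indicator_of_notMem hx, huΩ x hx, abs_zero, Real.zero_rpow (by linarith), zero_div,
          ENNReal.ofReal_zero]
    · rw [lintegral_indicator ho.measurableSet, setLIntegral_const]
      exact ENNReal.mul_lt_top ENNReal.ofReal_lt_top hb.measure_lt_top

end Energy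

/-! ### The weak form and its truncation -/

section WeakForm

variable {N : ℕ} {Ω : Set (E N)} {R s p κ : ℝ}

lemma integrable_of_gagliardo_univ {u : E N → ℝ} (hu : AEStronglyMeasurable u)
    (hfin : gagliardo s p Set.univ u < ∞) :
    Integrable fun z : E N × E N => |u z.1 - u z.2| ^ p / ‖z.1 - z.2‖ ^ ((N : ℝ) + p * s) := by
  have h1 : AEMeasurable (fun z : E N × E N => u z.1) := hu.aemeasurable.comp_fst
  have h2 : AEMeasurable (fun z : E N × E N => u z.2) := hu.aemeasurable.comp_snd
  refine ⟨AEMeasurable.aestronglyMeasurable (by fun_prop), ?_⟩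
  rw [hasFiniteIntegral_iff_ofReal (Filter.Eventually.of_forall fun z => by positivity)]
  rwa [gagliardo, Set.univ_prod_univ, Measure.restrict_univ] at hfin

lemma rpow_mul_le_rpow_add_rpow (hp : 1 < p) {a b : ℝ} (ha : 0 ≤ a) (hb : 0 ≤ b) :
    a ^ (p - 1) * b ≤ a ^ p + b ^ p := by
  have hpow : ∀ t : ℝ, 0 ≤ t → t ^ (p - 1) * t = t ^ p := by
    intro t ht
    nth_rewrite 2 [← Real.rpow_one t]
    rw [← Real.rpow_add_of_nonneg ht (by linarith) zero_le_one, sub_add_cancel]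
  have h1 : 0 ≤ p - 1 := by linarith
  have ha' := Real.rpow_nonneg ha p
  have hb' := Real.rpow_nonneg hb p
  rcases le_total a b with h | h
  · calc a ^ (p - 1) * b ≤ b ^ (p - 1) * b := by gcongr
      _ = b ^ p := hpow b hb
      _ ≤ _ := by linarith
  · calc a ^ (p - 1) * b ≤ a ^ (p - 1) * a := by gcongr
      _ = a ^ p := hpow a ha
      _ ≤ _ := by linarith

/-- A crude Young inequality, `a ^ (p - 1) b ≤ a ^ p + b ^ p`, dominates the integrand by the two
energy densities. -/
lemma integrable_weakIntegrand (hp : 1 < p) {u φ : E N → ℝ} (hu : AEStronglyMeasurable u)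
    (hφ : AEStronglyMeasurable φ) (hufin : gagliardo s p Set.univ u < ∞)
    (hφfin : gagliardo s p Set.univ φ < ∞) : Integrable (weakIntegrand s p u φ) := by
  refine ((integrable_of_gagliardo_univ hu hufin).add
    (integrable_of_gagliardo_univ hφ hφfin)).mono' ?_ (Filter.Eventually.of_forall fun z => ?_)
  · have h1 : AEMeasurable (fun z : E N × E N => u z.1) := hu.aemeasurable.comp_fst
    have h2 : AEMeasurable (fun z : E N × E N => u z.2) := hu.aemeasurable.comp_snd
    have h3 : AEMeasurable (fun z : E N × E N => φ z.1) := hφ.aemeasurable.comp_fst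
    have h4 : AEMeasurable (fun z : E N × E N => φ z.2) := hφ.aemeasurable.comp_snd
    have h5 := (measurable_spow (p - 1)).comp_aemeasurable (h1.sub h2)
    refine AEMeasurable.aestronglyMeasurable ?_
    exact (h5.mul (h3.sub h4)).div (by fun_prop)
  · have hw : ‖weakIntegrand s p u φ z‖ =
        |u z.1 - u z.2| ^ (p - 1) * |φ z.1 - φ z.2| / ‖z.1 - z.2‖ ^ ((N : ℝ) + p * s) := by
      rw [weakIntegrand, norm_div, norm_mul, Real.norm_eq_abs, Real.norm_eq_abs,
        abs_spow (by linarith), Real.norm_of_nonneg (by positivity)]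
    rw [hw, Pi.add_apply, ← add_div]
    gcongr
    exact rpow_mul_le_rpow_add_rpow hp (abs_nonneg _) (abs_nonneg _)

/-- The truncated weak form, in which the two terms can be separated. -/
lemma integral_truncated (hN : 0 < N) (hs0 : 0 < s) (hs1 : s < 1) (hp : 1 < p)
    (hκ0 : 0 < κ) (hκ1 : κ < 1) (ho : IsOpen Ω) (hne : Ωᶜ.Nonempty) {U : Set (E N)}
    (hUm : MeasurableSet U) (hU : U ⊆ Ω) {φ : E N → ℝ} (hφm : AEStronglyMeasurable φ)
    (hφ0 : ∀ᵐ x, x ∉ U → φ x = 0) (hφi : IntegrableOn (fun x => delta Ω x ^ (-s) * |φ x|) U) :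
    ∫ z : E N × E N, profile s p κ (delta Ω z.1) (delta Ω z.2) / ‖z.1 - z.2‖ ^ ((N : ℝ) + p * s) *
      (φ z.1 - φ z.2) = ∫ x in U, 2 * truncOp s p κ Ω x * φ x := by
  set K : E N × E N → ℝ := fun z =>
    profile s p κ (delta Ω z.1) (delta Ω z.2) / ‖z.1 - z.2‖ ^ ((N : ℝ) + p * s) with hK
  have hKm : Measurable K := measurable_profile_delta Ω
  set A : E N × E N → ℝ := fun z => K z * φ z.1 with hA
  have hAm : AEStronglyMeasurable A :=
    hKm.aestronglyMeasurable.mul (AEStronglyMeasurable.comp_fst hφm)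
  have hKi := fun x (hx : x ∈ Ω) => integrable_profile_delta hN hs0 hs1 hp hκ0 hκ1 ho hne hx
  -- Integrating first in `y`, the truncated kernel costs a multiple of `δ(x) ^ (-s)`, so Hardy's
  -- integrability of `δ ^ (-s) |φ|` gives absolute convergence on the product.
  have hAi : Integrable A := by
    rw [Measure.volume_eq_prod] at hAm ⊢
    rw [integrable_prod_iff hAm]
    constructor
    · filter_upwards [hφ0] with x hx
      by_cases hxU : x ∈ U
      · exact (hKi x (hU hxU)).1.mul_const (φ x)
      · simp [hA, hx hxU]
    · have hdom := ((integrable_indicator_iff hUm).2 hφi).const_mul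
        (sphereArea N * ((1 - κ) ^ (-s) / s))
      refine hdom.mono' hAm.norm.integral_prod_right' ?_
      filter_upwards [hφ0] with x hx
      rw [Real.norm_of_nonneg (integral_nonneg fun y => norm_nonneg _)]
      by_cases hxU : x ∈ U
      · rw [Set.indicator_of_mem hxU]
        simp only [hA, norm_mul]
        rw [integral_mul_const, Real.norm_eq_abs]
        have h1 := (hKi x (hU hxU)).2
        have hd := delta_pos ho hne (hU hxU)
        rw [Real.mul_rpow (by linarith) hd.le] at h1
        calc _ ≤ sphereArea N * ((1 - κ) ^ (-s) * delta Ω x ^ (-s) / s) * |φ x| := by gcongr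
          _ = _ := by ring
      · rw [Set.indicator_of_notMem hxU]
        simp [hA, hx hxU]
  -- Antisymmetry of the profile turns the term with `φ(y)` into a reflected copy of the one with
  -- `φ(x)`; this is the origin of the factor `2`.
  have hswap : ∀ z, K z * (φ z.1 - φ z.2) = A z + A z.swap := by
    intro z
    simp only [hA, hK, Prod.fst_swap, Prod.snd_swap]
    rw [profile_swap (delta Ω z.1), norm_sub_rev z.2]
    ring
  have hswi : ∫ z : E N × E N, A z.swap = ∫ z, A z := by
    rw [Measure.volume_eq_prod]
    exact integral_prod_swap A
  have hAi' : Integrable fun z : E N × E N => A z.swap := by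
    rw [Measure.volume_eq_prod] at hAi ⊢
    exact hAi.swap
  have hval : ∫ z, A z = ∫ x, truncOp s p κ Ω x * φ x := by
    rw [Measure.volume_eq_prod] at hAi ⊢
    rw [integral_prod _ hAi]
    refine integral_congr_ae (Filter.Eventually.of_forall fun x => ?_)
    simp only [hA, truncOp]
    rw [integral_mul_const]
  refine (integral_congr_ae (Filter.Eventually.of_forall hswap)).trans ?_
  rw [integral_add hAi hAi', hswi, hval, ← two_mul, ← integral_const_mul,
    setIntegral_eq_integral_of_ae_compl_eq_zero]
  · simp only [mul_assoc]
  · filter_upwards [hφ0] with x hx hxU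
    rw [hx hxU, mul_zero]

end WeakForm

end FracPLap

end

/-! ### Assembly of the theorem -/

theorem theorem3p6 (N : ℕ) (hN : 1 < N) (s p : ℝ) (hs0 : 0 < s) (hs1 : s < 1) (hp : 1 < p)
    (Ω : Set (FracPLap.E N)) (hΩo : IsOpen Ω) (hΩc : IsConnected Ω)
    (hΩb : Bornology.IsBounded Ω) (hΩ : FracPLap.HasC11Boundary Ω) :
    ∃ ρ : ℝ, 0 < ρ ∧ ∃ f : FracPLap.E N → ℝ,
      MemLp f ∞ (volume.restrict (FracPLap.nearBoundary Ω ρ)) ∧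
      FracPLap.IsWeakSolution s p (FracPLap.nearBoundary Ω ρ)
        (fun x => FracPLap.delta Ω x ^ s) f := by
  open FracPLap in
  have hN0 : 0 < N := by omega
  have : Nonempty (Fin N) := ⟨⟨0, hN0⟩⟩
  have hne' : Ω.Nonempty := hΩc.nonempty
  have hne : Ωᶜ.Nonempty := by
    rw [Set.nonempty_compl]
    rintro rfl
    exact NormedSpace.unbounded_univ ℝ (E N) hΩb
  have hps : 0 < p * s := by positivity
  obtain ⟨R, hR, hT⟩ := hΩ.exists_twoBall hΩo hΩb
  -- The strip in which every point admits a straightening, so `ρ = R / 24`.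
  set U := nearBoundary Ω (R / 24) with hUdef
  have hUo : IsOpen U := hΩo.inter ((continuous_delta Ω).isOpen_preimage _ isOpen_Iio)
  have hUΩ : U ⊆ Ω := fun x hx => hx.1
  have hUR : ∀ x ∈ U, delta Ω x ≤ R := fun x hx => by
    have : delta Ω x < R / 24 := hx.2
    linarith
  have hUf : volume U < ∞ := (hΩb.subset hUΩ).measure_lt_top
  have hUfin : IsFiniteMeasure (volume.restrict U) := ⟨by rwa [Measure.restrict_apply_univ]⟩
  -- Any sequence in `(0, 1)` tending to `1` would do.
  set κ : ℕ → ℝ := fun k => 1 - 1 / ((k : ℝ) + 2) with hκdef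
  have hκpos : ∀ k : ℕ, 0 < 1 / ((k : ℝ) + 2) := fun k => by positivity
  have hκ1 : ∀ k, κ k < 1 := fun k => by
    have := hκpos k
    simp only [hκdef]
    linarith
  have hκ0 : ∀ k, 0 < κ k := fun k => by
    simp only [hκdef]
    rw [sub_pos, div_lt_one (by positivity)]
    have : (0 : ℝ) ≤ k := k.cast_nonneg
    linarith
  have hκ : Filter.Tendsto κ Filter.atTop (nhds 1) := by
    have h1 : Filter.Tendsto (fun k : ℕ => 1 / ((k : ℝ) + 2)) Filter.atTop (nhds 0) :=
      Filter.Tendsto.const_div_atTop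
        (Filter.tendsto_atTop_add_const_right _ _ tendsto_natCast_atTop_atTop) _
    have h2 := h1.const_sub 1
    rwa [sub_zero] at h2
  set C := errorConst N s p R
  set C' := layerConst (N - 1) (N + p * s) / (p * s)
  have hC' : 0 ≤ C' := div_nonneg (layerConst_nonneg _ _) hps.le
  have hmain := fun x (hx : x ∈ U) =>
    exists_tendsto_truncOp hN0 hs0 hs1 hp hκ0 hκ1 hκ hΩo hne hR hT hx.1 hx.2
  -- Outside `U` this may be a default value; only its restriction to `U`, where the limit exists,
  -- is used.
  set f : E N → ℝ := fun x => 2 * Filter.limUnder Filter.atTop fun k => truncOp s p (κ k) Ω x with hf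
  have hflim : ∀ x ∈ U, |f x| ≤ 2 * C ∧
      Filter.Tendsto (fun k => 2 * truncOp s p (κ k) Ω x) Filter.atTop (nhds (f x)) := by
    intro x hx
    obtain ⟨L, hL, hlim⟩ := (hmain x hx).1
    have hfx : f x = 2 * L := by
      simp only [hf]
      rw [hlim.limUnder_eq]
    rw [hfx, abs_mul, abs_two]
    exact ⟨by linarith, hlim.const_mul 2⟩
  have hfm : AEStronglyMeasurable f (volume.restrict U) :=
    aestronglyMeasurable_of_tendsto_ae Filter.atTop
      (fun k => ((stronglyMeasurable_truncOp Ω).const_mul 2).aestronglyMeasurable)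
      (ae_restrict_of_forall_mem hUo.measurableSet fun x hx => (hflim x hx).2)
  refine ⟨R / 24, by positivity, f, memLp_top_of_bound hfm (2 * C)
    (ae_restrict_of_forall_mem hUo.measurableSet fun x hx => (hflim x hx).1),
    hT.memWtilde_delta_rpow hN0 hs0 hs1 hp hR hΩo hΩb hne' hne _, fun φ hφ => ?_⟩
  have hφm : AEStronglyMeasurable φ := by
    have := hφ.1.1.1
    rwa [Measure.restrict_univ] at this
  have hum : AEStronglyMeasurable fun x : E N => delta Ω x ^ s := by
    have := (continuous_delta Ω).measurable
    exact Measurable.aestronglyMeasurable (by fun_prop)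
  have hφi : IntegrableOn (fun x => delta Ω x ^ (-s) * |φ x|) U :=
    hT.integrableOn_delta_rpow_mul hN0 hs0 hp hR hΩo hΩb hne hUo.measurableSet hUΩ hUR hφ
  have hφ1 : IntegrableOn φ U := by
    have h1 := hφ.1.1
    rw [Measure.restrict_univ] at h1
    exact (h1.mono_measure Measure.restrict_le_self).integrable (by simpa using hp.le)
  have hwi : Integrable (weakIntegrand s p (fun x => delta Ω x ^ s) φ) :=
    integrable_weakIntegrand hp hum hφm
      (hT.gagliardo_delta_rpow_lt_top hN0 hs0 hs1 hp hR hΩo hΩb hne' hne) hφ.1.2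
  refine ⟨hwi, ?_, ?_⟩
  · refine (hφ1.norm.const_mul (2 * C)).mono' (hfm.mul hφm.restrict)
      (ae_restrict_of_forall_mem hUo.measurableSet fun x hx => ?_)
    rw [norm_mul]
    exact mul_le_mul_of_nonneg_right (hflim x hx).1 (norm_nonneg _)
  -- The cut-off only sets part of the integrand to zero, so the full weak integrand dominates.
  have hL : Filter.Tendsto (fun k => ∫ z : E N × E N,
      profile s p (κ k) (delta Ω z.1) (delta Ω z.2) / ‖z.1 - z.2‖ ^ ((N : ℝ) + p * s) *
        (φ z.1 - φ z.2)) Filter.atTop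
      (nhds (∫ z, weakIntegrand s p (fun x => delta Ω x ^ s) φ z)) := by
    refine tendsto_integral_of_dominated_convergence _ (fun k => ?_) hwi.norm (fun k => ?_) ?_
    · exact (measurable_profile_delta Ω).aestronglyMeasurable.mul
        ((AEStronglyMeasurable.comp_fst hφm).sub (AEStronglyMeasurable.comp_snd hφm))
    · refine Filter.Eventually.of_forall fun z => ?_
      rw [weakIntegrand, div_mul_eq_mul_div, norm_div, norm_div, norm_mul, norm_mul]
      gcongr
      exact abs_profile_le_abs_spow _ _
    · refine Filter.Eventually.of_forall fun z => ?_
      rw [weakIntegrand, mul_div_right_comm]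
      exact ((tendsto_profile _ _ hκ).div_const _).mul_const _
  -- The truncated operators are not known to be bounded uniformly in `k`; the extra `δ ^ (-s)` in
  -- the majorant is integrable against `φ` by Hardy.
  have hRt : Filter.Tendsto (fun k => ∫ x in U, 2 * truncOp s p (κ k) Ω x * φ x) Filter.atTop
      (nhds (∫ x in U, f x * φ x)) := by
    refine tendsto_integral_of_dominated_convergence
      (fun x => 2 * C * ‖φ x‖ + 2 * C' * (delta Ω x ^ (-s) * |φ x|)) (fun k => ?_)
      ((hφ1.norm.const_mul _).add (hφi.const_mul _)) (fun k => ?_) ?_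
    · exact ((stronglyMeasurable_truncOp Ω).const_mul 2).aestronglyMeasurable.mul hφm.restrict
    · refine ae_restrict_of_forall_mem hUo.measurableSet fun x hx => ?_
      have h1 := (hmain x hx).2 k
      rw [norm_mul, norm_mul, Real.norm_two, Real.norm_eq_abs, Real.norm_eq_abs]
      calc 2 * |truncOp s p (κ k) Ω x| * |φ x| ≤ 2 * (C + C' * delta Ω x ^ (-s)) * |φ x| := by gcongr
        _ = _ := by ring
    · exact ae_restrict_of_forall_mem hUo.measurableSet fun x hx => (hflim x hx).2.mul_const _
  -- For each `k` the two truncated expressions coincide, hence so do their limits.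
  refine tendsto_nhds_unique hL (hRt.congr fun k => ?_)
  exact (integral_truncated hN0 hs0 hs1 hp (hκ0 k) (hκ1 k) hΩo hne hUo.measurableSet hUΩ hφm hφ.2
    hφi).symm
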